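/- Let $K$ be an algebraically closed field of characteristic $0$ and let $n\ge 0$, $N\ge n+2$. Let $B\subset\mathbb{G}(1,N)$ be an irreducible closed subvariety of dimension $n$ of the Grassmannian of lines in $\mathbb{P}^N=\mathbb{P}(V)$ (closed in the Plücker embedding), and suppose that the union of the lines belonging to $B$ is an algebraic variety $X\subset\mathbb{P}^N$ of dimension $n+1$. For a line $r=\mathbb{P}(\hat r)$ in $B$, regard the Zariski tangent space $T_rB$ as a subspace of $T_r\mathbb{G}(1,N)=\operatorname{Hom}(\hat r,V/\hat r)$. The characteristic map of $B$ relative to $r$, $$\chi(r):\ T_rB\otimes\mathcal{O}_r\longrightarrow \mathcal{N}_{r|\mathbb{P}^N}\cong (V/\hat r)\otimes\mathcal{O}_r(1),$$ is the map induced by the inclusion of $T_rB$ in the tangent spaces of $B\times\mathbb{P}^N$ followed by the projection to the normal spaces of the incidence correspondence $\{(s,x) : x\in s\}\subset B\times\mathbb{P}^N$; over $[v]\in r$ it is, up to sign, $\eta\mapsto\eta(v)$. The focal locus on $r$ is the closed subscheme of $r\cong\mathbb{P}^1$ where $\chi(r)$ does not have maximal rank, defined by the minors of $\chi(r)$ of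 order $\min\{\dim T_rB,\,N-1\}$. A property holds for the general $r\in B$ if it holds for all $r$ in some non-empty Zariski open subset of $B$. The tangent space to $X$ is constant along $r$ if the embedded tangent spaces $\mathbb{T}_xX$ at all the nonsingular points $x$ of $X$ lying on $r$ coincide. Then the following are equivalent: (i) for the general $r\in B$, the focal locus on $r$ consists of $n$ points counted with multiplicity, i.e. it is a finite scheme of length $n$; (ii) the tangent space to $X$ is constant along every line $r$ of $B$; (ii$'$) the tangent space to $X$ is constant along the general line $r$ of $B$. -/

import Mathlib

open scoped LinearAlgebra.Projectivization

noncomputable section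

namespace FocalLines

/-! ### Projective varieties -/

section Varieties

variable {K : Type*} [Field K] {σ : Type}

/-- The ideal `I(Z)` of a set `Z` of points of `ℙ(K^σ)`: all polynomials that vanish at every
vector representing a point of `Z`. -/
def idealOf (Z : Set (ℙ K (σ → K))) : Ideal (MvPolynomial σ K) where
  carrier := {F | ∀ (v : σ → K) (hv : v ≠ 0), Projectivization.mk K v hv ∈ Z →
    MvPolynomial.eval v F = 0}
  zero_mem' _ _ _ := map_zero _
  add_mem' hF hG v hv hZ := by rw [map_add, hF v hv hZ, hG v hv hZ, add_zero]
  smul_mem' c F hF v hv hZ := by rw [smul_eq_mul, map_mul, hF v hv hZ, mul_zero]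

/-- Zariski closed: the common zero set of a family of homogeneous polynomials. -/
def IsZariskiClosed (Z : Set (ℙ K (σ → K))) : Prop :=
  ∃ S : Set (MvPolynomial σ K), (∀ F ∈ S, ∃ d : ℕ, F.IsHomogeneous d) ∧
    ∀ x : ℙ K (σ → K), x ∈ Z ↔ ∀ F ∈ S, MvPolynomial.eval x.rep F = 0

/-- An (irreducible, closed) projective variety. -/
def IsProjectiveVariety (Z : Set (ℙ K (σ → K))) : Prop :=
  IsZariskiClosed Z ∧ (idealOf Z).IsPrime

/-- Transcendence degree of the homogeneous coordinate ring `K[x] / I(Z)`; for a variety `Z` this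
is the dimension of the affine cone over `Z`, that is `dim Z + 1`. -/
def coneDim (Z : Set (ℙ K (σ → K))) : Cardinal :=
  Algebra.trdeg K (MvPolynomial σ K ⧸ idealOf Z)

/-- The variety `Z` has dimension `d`. -/
def HasDim (Z : Set (ℙ K (σ → K))) (d : ℕ) : Prop :=
  coneDim Z = ((d + 1 : ℕ) : Cardinal)

/-- The differential of the polynomial `F` at `v`. -/
def polyDifferential [Fintype σ] (F : MvPolynomial σ K) (v : σ → K) : (σ → K) →ₗ[K] K :=
  ∑ i, MvPolynomial.eval v (MvPolynomial.pderiv i F) • LinearMap.proj i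

/-- The embedded tangent space to `Z` at `x`, as a linear subspace of `K^σ`: the vectors killed
by the differentials at `x` of all polynomials in `I(Z)`. -/
def embTangent [Fintype σ] (Z : Set (ℙ K (σ → K))) (x : ℙ K (σ → K)) : Submodule K (σ → K) :=
  ⨅ F ∈ idealOf Z, LinearMap.ker (polyDifferential F x.rep)

/-- `x` is a nonsingular point of `Z`: the embedded tangent space has the dimension of `Z`. -/
def IsNonsingularAt [Fintype σ] (Z : Set (ℙ K (σ → K))) (x : ℙ K (σ → K)) : Prop :=
  x ∈ Z ∧ (Module.finrank K (embTangent Z x) : Cardinal) = coneDim Z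

end Varieties

/-! ### The characteristic map -/

section Characteristic

variable {K V T : Type*} [Field K] [AddCommGroup V] [Module K V] [AddCommGroup T] [Module K T]
  {R : Submodule K V} (θ : T →ₗ[K] R →ₗ[K] V ⧸ R) (v : R)

/-- Let `T = T_r B` be the tangent space to a family `B` at `r`, let `R = r̂`, and let `θ` be the
inclusion of `T_r B` in `Hom(r̂, V / r̂)`. This is the tangent space at `(r, v)`, `v ∈ r̂`, to the incidence correspondence
`{(s, w) | w ∈ ŝ} ⊆ B × V`: the first-order deformation of `r̂` with direction `θ η` consists of the
vectors `a + ε b` with `a ∈ r̂` and `b ≡ θ η a` modulo `r̂`, so `(η, w)` is tangent if and only if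
`v + ε w` lies in it. -/
def incidenceTangent : Submodule K (T × V) :=
  LinearMap.ker (R.mkQ ∘ₗ LinearMap.snd K T V -
    LinearMap.applyₗ v ∘ₗ θ ∘ₗ LinearMap.fst K T V)

theorem mem_incidenceTangent (p : T × V) :
    p ∈ incidenceTangent θ v ↔ R.mkQ p.2 = θ p.1 v := by
  simp [incidenceTangent, sub_eq_zero]

/-- The normal space at `(r, v)` to the incidence correspondence inside `B × V`. -/
abbrev NormalSpace : Type _ := (T × V) ⧸ incidenceTangent θ v

/-- The map from the normal space `V / r̂` of `r̂` in `V` to the normal space of the incidence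
correspondence, induced by the inclusion of the fibre `{r} × V` in `B × V`. -/
def normalMap : (V ⧸ R) →ₗ[K] NormalSpace θ v :=
  R.liftQ ((incidenceTangent θ v).mkQ ∘ₗ LinearMap.inr K T V) <| by
    intro w hw
    rw [LinearMap.mem_ker, LinearMap.comp_apply, Submodule.mkQ_apply,
      Submodule.Quotient.mk_eq_zero, mem_incidenceTangent]
    simpa using hw

theorem normalMap_mkQ (w : V) :
    normalMap θ v (R.mkQ w) = (incidenceTangent θ v).mkQ (0, w) := rfl

theorem normalMap_bijective : Function.Bijective (normalMap θ v) := by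
  constructor
  · rw [← LinearMap.ker_eq_bot, LinearMap.ker_eq_bot']
    intro w hw
    obtain ⟨w, rfl⟩ := R.mkQ_surjective w
    rw [normalMap_mkQ, Submodule.mkQ_apply, Submodule.Quotient.mk_eq_zero,
      mem_incidenceTangent] at hw
    simpa using hw
  · intro y
    obtain ⟨⟨η, w⟩, rfl⟩ := (incidenceTangent θ v).mkQ_surjective y
    obtain ⟨u, hu⟩ := R.mkQ_surjective (θ η v)
    refine ⟨R.mkQ (w - u), ?_⟩
    rw [normalMap_mkQ, Submodule.mkQ_apply, Submodule.mkQ_apply, Submodule.Quotient.eq,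
      mem_incidenceTangent]
    simpa using hu

/-- The characteristic map of the family relative to `r`, at the point `v ∈ r̂`: the composite
`T_r B → T_{(r,v)}(B × V) → N_{(r,v)} ≃ V / r̂`. -/
def characteristicMap : T →ₗ[K] V ⧸ R :=
  (LinearEquiv.ofBijective (normalMap θ v) (normalMap_bijective θ v)).symm.toLinearMap ∘ₗ
    (incidenceTangent θ v).mkQ ∘ₗ LinearMap.inl K T V

/-- Up to sign, the characteristic map is the evaluation of homomorphisms; in particular it is
linear in `v`. -/
theorem characteristicMap_apply (η : T) :
    characteristicMap θ v η = -θ η v := by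
  obtain ⟨u, hu⟩ := R.mkQ_surjective (θ η v)
  rw [characteristicMap, LinearMap.comp_apply, LinearEquiv.coe_coe, LinearEquiv.symm_apply_eq,
    LinearEquiv.ofBijective_apply, ← hu, ← map_neg, normalMap_mkQ, LinearMap.comp_apply,
    Submodule.mkQ_apply, Submodule.mkQ_apply, Submodule.Quotient.eq, mem_incidenceTangent]
  simpa using hu

end Characteristic

/-! ### The Grassmannian of lines -/

section Grassmannian

variable (K : Type*) [Field K] (N : ℕ)

/-- The underlying vector space `V` of `ℙ^N = ℙ(V)`. -/
abbrev Vec : Type _ := Fin (N + 1) → K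

/-- Index set of the coordinates `p_{ij}` of the (redundant) Plücker space. -/
abbrev PlIdx : Type := Fin (N + 1) × Fin (N + 1)

/-- The Grassmannian `𝔾(1, N)`: lines in `ℙ^N`, i.e. two-dimensional subspaces of `V`. -/
abbrev Line : Type _ := {r : Submodule K (Vec K N) // Module.finrank K r = 2}

variable {K N}

/-- The exterior product `u ∧ v` as the antisymmetric matrix `(u_i v_j - u_j v_i)`. -/
def wedge : Vec K N →ₗ[K] Vec K N →ₗ[K] (PlIdx N → K) :=
  LinearMap.mk₂ K (fun u v p => u p.1 * v p.2 - u p.2 * v p.1)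
    (fun _ _ _ => by ext; simp; ring) (fun _ _ _ => by ext; simp; ring)
    (fun _ _ _ => by ext; simp; ring) (fun _ _ _ => by ext; simp; ring)

theorem wedge_apply (u v : Vec K N) (p : PlIdx N) :
    wedge u v p = u p.1 * v p.2 - u p.2 * v p.1 := rfl

/-- A chosen basis of the plane `r̂ ⊆ V` over the line `r`. -/
def lineBasis (r : Line K N) : Module.Basis (Fin 2) K r.1 :=
  have : Module.Finite K r.1 := Module.finite_of_finrank_pos (by rw [r.2]; norm_num)
  Module.finBasisOfFinrankEq K r.1 r.2

theorem wedge_lineBasis_ne_zero (r : Line K N) :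
    wedge (lineBasis r 0 : Vec K N) (lineBasis r 1 : Vec K N) ≠ 0 := by
  intro h
  have hli : LinearIndependent K ![lineBasis r 0, lineBasis r 1] := by
    convert (lineBasis r).linearIndependent using 1
    ext i
    fin_cases i <;> rfl
  have h0 : (lineBasis r 0 : Vec K N) ≠ 0 := by
    simpa using (lineBasis r).ne_zero 0
  obtain ⟨i, hi⟩ := Function.ne_iff.mp h0
  rw [LinearIndependent.pair_iff' ((lineBasis r).ne_zero 0)] at hli
  refine hli ((lineBasis r 1 : Vec K N) i / (lineBasis r 0 : Vec K N) i) ?_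
  ext j
  have hj := congrFun h (i, j)
  simp only [wedge_apply, Pi.zero_apply] at hj hi
  simp only [Submodule.coe_smul, Pi.smul_apply, smul_eq_mul]
  field_simp
  linear_combination -hj

/-- The Plücker embedding. -/
def pluecker (r : Line K N) : ℙ K (PlIdx N → K) :=
  Projectivization.mk K (wedge (lineBasis r 0 : Vec K N) (lineBasis r 1 : Vec K N))
    (wedge_lineBasis_ne_zero r)

/-- A property holds for the general element of `B`: it holds for all elements of `B` outside
a Zariski closed set that does not contain all of `B`. -/
def ForGeneral (B : Set (Line K N)) (P : Line K N → Prop) : Prop :=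
  ∃ C : Set (ℙ K (PlIdx N → K)), IsZariskiClosed C ∧ (∃ r ∈ B, pluecker r ∉ C) ∧
    ∀ r ∈ B, pluecker r ∉ C → P r

/-- The union in `ℙ^N` of the lines belonging to `B`. -/
def unionOfLines (B : Set (Line K N)) : Set (ℙ K (Vec K N)) :=
  {x | ∃ r ∈ B, x.submodule ≤ r.1}

/-! ### Tangent spaces to a family of lines -/

/-- The derivative at `t = 0` of `(b₀ + t A b₀) ∧ (b₁ + t A b₁)`, where `b₀, b₁` is the basis
of `r̂`, as a linear function of `A : r̂ → V`. -/
def plueckerDifferential (r : Line K N) : (r.1 →ₗ[K] Vec K N) →ₗ[K] (PlIdx N → K) :=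
  wedge (lineBasis r 0 : Vec K N) ∘ₗ LinearMap.applyₗ (lineBasis r 1) +
    wedge.flip (lineBasis r 1 : Vec K N) ∘ₗ LinearMap.applyₗ (lineBasis r 0)

/-- The Zariski tangent space `T_r B`, as a subspace of `T_r 𝔾(1, N) = Hom(r̂, V / r̂)`: the
classes of the `A : r̂ → V` for which the first-order deformation of `r` spanned by
`b₀ + ε A b₀` and `b₁ + ε A b₁` satisfies the equations of `B` to first order. -/
def tangentSpace (B : Set (Line K N)) (r : Line K N) :
    Submodule K (r.1 →ₗ[K] Vec K N ⧸ r.1) :=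
  ((embTangent (pluecker '' B) (pluecker r)).comap (plueckerDifferential r)).map
    (LinearMap.compRight K r.1.mkQ)

/-! ### The focal locus -/

/-- The maximal rank allowed to the characteristic map relative to `r` by the ranks of its source
and of its target. -/
def maxRank (B : Set (Line K N)) (r : Line K N) : ℕ :=
  min (Module.finrank K (tangentSpace B r)) (Module.finrank K (Vec K N ⧸ r.1))

/-- For `η ∈ T_r B` and a linear form `l` on `V / r̂`, the linear form `v ↦ l (χ(v) η)` on `r̂`,
written in the coordinates `x₀, x₁` of `v = x₀ b₀ + x₁ b₁`. -/
def characteristicEntry (B : Set (Line K N)) (r : Line K N)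
    (l : Module.Dual K (Vec K N ⧸ r.1)) (η : tangentSpace B r) : MvPolynomial (Fin 2) K :=
  ∑ k, MvPolynomial.C (l (characteristicMap (tangentSpace B r).subtype (lineBasis r k) η)) * MvPolynomial.X k

/-- The homogeneous ideal, in the coordinate ring `K[x₀, x₁]` of `r`, of the focal subscheme on
`r`. It is generated by the minors of order `maxRank` of the characteristic map, written without
a choice of bases of `T_r B` and of `V / r̂`. -/
def focalIdeal (B : Set (Line K N)) (r : Line K N) : Ideal (MvPolynomial (Fin 2) K) :=
  Ideal.span {F | ∃ (l : Fin (maxRank B r) → Module.Dual K (Vec K N ⧸ r.1))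
    (η : Fin (maxRank B r) → tangentSpace B r),
    F = (Matrix.of fun i j => characteristicEntry B r (l i) (η j)).det}

/-- The subscheme of `ℙ¹` defined by the homogeneous ideal `J ⊆ K[x₀, x₁]` is finite of length
`d`, i.e. consists of `d` points counted with multiplicity: its Hilbert polynomial is the
constant `d`. -/
def HasLength {K : Type*} [Field K] (J : Ideal (MvPolynomial (Fin 2) K)) (d : ℕ) : Prop :=
  ∀ᶠ e in Filter.atTop, Module.finrank K (MvPolynomial.homogeneousSubmodule (Fin 2) K e ⧸
    (J.restrictScalars K).comap (MvPolynomial.homogeneousSubmodule (Fin 2) K e).subtype) = d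

/-- The tangent space to `X` is constant along `r`: it is the same linear space at all the
nonsingular points of `X` that lie on `r`. -/
def ConstantTangentAlong (X : Set (ℙ K (Vec K N))) (r : Line K N) : Prop :=
  ∃ P : Submodule K (Vec K N), ∀ x : ℙ K (Vec K N), x.submodule ≤ r.1 →
    IsNonsingularAt X x → embTangent X x = P

end Grassmannian

end FocalLines

end

/-!
Let `v` be a vector of a line `r̂`. By generic smoothness in characteristic `0`, applied to the
map from the incidence correspondence onto `X`, for general `r` and `v` the tangent space at `v`
to the cone over `X` is the preimage in `V` of `{η v | η ∈ T_r B} ⊆ V / r̂`, the image of `χ(r)`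
at `v`. So the tangent space to `X` is constant along `r` if and only if the image of `χ(r)` at
`v` does not depend on `v`.

For general `v` the map `χ(r)` is injective with an `n`-dimensional source. If its image is
constant, then its maximal minors are multiples of one form of degree `n`, and the focal scheme
has length `n`. Conversely, if the focal scheme has length `n`, then all the maximal minors are
proportional, and Cramer's rule shows that a linear form vanishing on one image of maximal rank
vanishes on all of them.

The passage from the general line to every line is the semicontinuity of the dimension of the
space of vectors tangent to the cone over `X` at all the points of `r̂`: its general value is
`n + 2`, which is the dimension of the tangent space at every nonsingular point.
-/

noncomputable section

namespace FocalLines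

open MvPolynomial

section Specialization

variable {A E E₀ m κ : Type*} [CommRing A] [Field E] [Field E₀]

theorem exists_det_submatrix_ne_zero [Finite m] [Fintype κ] [DecidableEq κ] {M : Matrix κ m E}
    (hM : LinearIndependent E M.row) : ∃ e : κ → m, (M.submatrix id e).det ≠ 0 := by
  have := Fintype.ofFinite m
  have hspan : Submodule.span E (Set.range M.col) = ⊤ := by
    rw [← Matrix.range_mulVecLin]
    refine Submodule.eq_top_of_finrank_eq ?_
    rw [Module.finrank_fintype_fun_eq_card]
    exact LinearIndependent.rank_matrix hM
  obtain ⟨ι, a, -, ha, hli⟩ := exists_linearIndependent' E M.col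
  let b := Module.Basis.mk hli (by rw [ha, hspan])
  let e := (Pi.basisFun E κ).indexEquiv b
  refine ⟨a ∘ e, (((Matrix.isUnit_iff_isUnit_det _).1 ?_).ne_zero)⟩
  exact Matrix.linearIndependent_cols_iff_isUnit.1 (hli.comp e e.injective)

theorem linearIndependent_row_of_det_submatrix_ne_zero [Fintype κ] [DecidableEq κ]
    {M : Matrix κ m E} {e : κ → m} (he : (M.submatrix id e).det ≠ 0) : LinearIndependent E M.row :=
  LinearIndependent.of_comp (LinearMap.funLeft E E e)
    (Matrix.linearIndependent_rows_of_det_ne_zero he)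

theorem exists_linearIndependent_specialization [Finite m] [Finite κ] (s : κ → m → A)
    (f₀ : A →+* E₀) (h₀ : LinearIndependent E₀ fun k i => f₀ (s k i)) :
    ∃ g : A, f₀ g ≠ 0 ∧ ∀ f : A →+* E, f g ≠ 0 → LinearIndependent E fun k i => f (s k i) := by
  classical
  have := Fintype.ofFinite κ
  obtain ⟨e, he⟩ := exists_det_submatrix_ne_zero (M := (Matrix.of s).map f₀) h₀
  refine ⟨((Matrix.of s).submatrix id e).det, ?_, fun f hf => ?_⟩
  · rwa [RingHom.map_det]
  · rw [RingHom.map_det] at hf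
    exact linearIndependent_row_of_det_submatrix_ne_zero (M := (Matrix.of s).map f) hf

theorem finrank_ker_mulVecLin_add_card [Fintype m] [Fintype κ] {M : Matrix κ m E}
    (hM : LinearIndependent E M.row) :
    Module.finrank E (LinearMap.ker M.mulVecLin) + Fintype.card κ = Fintype.card m := by
  have h := M.mulVecLin.finrank_range_add_finrank_ker
  have hrank : Module.finrank E (LinearMap.range M.mulVecLin) = Fintype.card κ := hM.rank_matrix
  rwa [hrank, add_comm, Module.finrank_fintype_fun_eq_card] at h

theorem exists_finrank_ker_mulVecLin_le {ι : Type*} [Fintype m] (M : Matrix ι m A)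
    (f₀ : A →+* E₀) :
    ∃ g : A, f₀ g ≠ 0 ∧ ∀ f : A →+* E, f g ≠ 0 →
      Module.finrank E (LinearMap.ker (M.map f).mulVecLin) ≤
        Module.finrank E₀ (LinearMap.ker (M.map f₀).mulVecLin) := by
  obtain ⟨κ, a, -, hspan, hli⟩ := exists_linearIndependent' E₀ (M.map f₀).row
  have := hli.finite
  have := Fintype.ofFinite κ
  obtain ⟨g, hg, hgen⟩ := exists_linearIndependent_specialization (E := E) (M ∘ a) f₀ hli
  refine ⟨g, hg, fun f hf => ?_⟩
  have hker : LinearMap.ker ((M.submatrix a id).map f₀).mulVecLin ≤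
      LinearMap.ker (M.map f₀).mulVecLin := fun x hx => by
    have hrows : Submodule.span E₀ (Set.range (M.map f₀).row) ≤
        LinearMap.ker ((dotProductBilin E₀ E₀).flip x) := by
      rw [← hspan, Submodule.span_le]
      rintro _ ⟨k, rfl⟩
      exact congrFun hx k
    exact funext fun i => hrows (Submodule.subset_span ⟨i, rfl⟩)
  have hker' : LinearMap.ker (M.map f).mulVecLin ≤
      LinearMap.ker ((M.submatrix a id).map f).mulVecLin := fun x hx =>
    funext fun k => congrFun hx (a k)
  have hcard := finrank_ker_mulVecLin_add_card (M := (M.submatrix a id).map f₀) hli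
  have hcard' := finrank_ker_mulVecLin_add_card (M := (M.submatrix a id).map f) (hgen f hf)
  have hle := Submodule.finrank_mono hker
  have hle' := Submodule.finrank_mono hker'
  lia

end Specialization

section Evaluation

variable {R σ τ : Type*} [CommSemiring R]

theorem eval_bind₁ (f : σ → MvPolynomial τ R) (F : MvPolynomial σ R) (v : τ → R) :
    eval v (bind₁ f F) = eval (fun i => eval v (f i)) F :=
  eval₂Hom_bind₁ _ _ _ _

theorem eval_toMvPolynomial_toMatrix' [Fintype τ] [DecidableEq τ] (L : (τ → R) →ₗ[R] σ → R)
    (x : τ → R) : (fun i => eval x (L.toMatrix'.toMvPolynomial i)) = L x :=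
  funext fun i => (Matrix.toMvPolynomial_eval_eq_apply _ i x).trans <|
    congrFun (LinearMap.toMatrix'_mulVec L x) i

theorem eval_smul_of_isHomogeneous {F : MvPolynomial σ R} {d : ℕ} (hF : F.IsHomogeneous d)
    (c : R) (v : σ → R) : eval (c • v) F = c ^ d * eval v F := by
  rw [eval_eq, eval_eq, Finset.mul_sum]
  refine Finset.sum_congr rfl fun m hm => ?_
  simp only [Pi.smul_apply, smul_eq_mul, mul_pow, Finset.prod_mul_distrib,
    Finset.prod_pow_eq_pow_sum, ← hF.degree_eq_sum_deg_support hm]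
  ring

theorem eval_smul_eq_sum (F : MvPolynomial σ R) (c : R) (v : σ → R) :
    eval (c • v) F =
      ∑ d ∈ Finset.range (F.totalDegree + 1), c ^ d * eval v (homogeneousComponent d F) := by
  conv_lhs => rw [← sum_homogeneousComponent F]
  rw [map_sum]
  exact Finset.sum_congr rfl fun d _ =>
    eval_smul_of_isHomogeneous (homogeneousComponent_isHomogeneous d F) c v

theorem eval_homogeneousComponent_eq_zero {K : Type*} [Field K] [Infinite K]
    {F : MvPolynomial σ K} {v : σ → K} (h : ∀ c : K, c ≠ 0 → eval (c • v) F = 0) (d : ℕ) :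
    eval v (homogeneousComponent d F) = 0 := by
  let P : Polynomial K := ∑ d ∈ Finset.range (F.totalDegree + 1),
    Polynomial.monomial d (eval v (homogeneousComponent d F))
  have hPeval (c : K) : P.eval c = eval (c • v) F := by
    simp [P, eval_smul_eq_sum, Polynomial.eval_finsetSum, mul_comm]
  have hP : P = 0 := P.eq_zero_of_infinite_isRoot <|
    (Set.finite_singleton (0 : K)).infinite_compl.mono fun c hc => (hPeval c).trans (h c hc)
  by_cases hd : d < F.totalDegree + 1
  · simpa [P, Polynomial.finsetSum_coeff, Polynomial.coeff_monomial, hd] using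
      congrArg (Polynomial.coeff · d) hP
  · rw [homogeneousComponent_eq_zero d F (by lia), map_zero]

theorem derivation_aeval {R A : Type*} [CommRing R] [CommRing A] [Algebra R A] [Fintype σ]
    (D : Derivation R A A) (y : σ → A) (F : MvPolynomial σ R) :
    D (aeval y F) = ∑ i, aeval y (pderiv i F) * D (y i) := by
  classical
  induction F using MvPolynomial.induction_on with
  | C a => simp [algHom_C]
  | add p q hp hq => simp only [map_add, hp, hq, add_mul, Finset.sum_add_distrib]
  | mul_X p j hp =>
    have hterm (i : σ) : aeval y (pderiv i (p * X j)) * D (y i) =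
        y j * (aeval y (pderiv i p) * D (y i)) + if i = j then aeval y p * D (y j) else 0 := by
      split_ifs with hij
      · subst hij; simp; ring
      · simp [pderiv_X_of_ne (Ne.symm hij), mul_assoc]
    rw [Finset.sum_congr rfl fun i _ => hterm i, Finset.sum_add_distrib, ← Finset.mul_sum, ← hp,
      Finset.sum_ite_eq' Finset.univ j, if_pos (Finset.mem_univ j), map_mul, aeval_X, D.leibniz,
      smul_eq_mul, smul_eq_mul, add_comm]

end Evaluation

section Differentials

variable {K : Type*} [Field K] {σ τ : Type} [Fintype σ]

theorem polyDifferential_apply (F : MvPolynomial σ K) (v x : σ → K) :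
    polyDifferential F v x = ∑ i, eval v (pderiv i F) * x i := by
  simp [polyDifferential]

theorem polyDifferential_apply_eq_eval (F : MvPolynomial σ K) (v x : σ → K) :
    polyDifferential F v x = eval v (mkDerivation K (fun i => C (x i)) F) := by
  conv_rhs => rw [← aeval_X_left_apply F]
  rw [derivation_aeval]
  simp [polyDifferential_apply]

theorem polyDifferential_bind₁ [Fintype τ] (f : σ → MvPolynomial τ K) (F : MvPolynomial σ K)
    (v x : τ → K) :
    polyDifferential (bind₁ f F) v x =
      polyDifferential F (fun i => eval v (f i)) (fun i => polyDifferential (f i) v x) := by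
  rw [polyDifferential_apply_eq_eval, ← aeval_eq_bind₁, derivation_aeval, polyDifferential_apply]
  simp only [map_sum, map_mul, aeval_eq_bind₁, eval_bind₁, polyDifferential_apply_eq_eval]

theorem polyDifferential_self_of_isHomogeneous {F : MvPolynomial σ K} {d : ℕ}
    (hF : F.IsHomogeneous d) (v : σ → K) : polyDifferential F v v = d * eval v F := by
  have h := congrArg (eval v) hF.sum_X_mul_pderiv
  simp only [map_sum, map_mul, eval_X, nsmul_eq_mul, map_natCast] at h
  simpa only [polyDifferential_apply, mul_comm (v _)] using h

/-- The differential at `v` of the polynomial map `K^σ → K^τ` with components `f j`. -/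
def mapDifferential (f : τ → MvPolynomial σ K) (v : σ → K) : (σ → K) →ₗ[K] τ → K :=
  LinearMap.pi fun j => polyDifferential (f j) v

theorem mapDifferential_apply (f : τ → MvPolynomial σ K) (v x : σ → K) (j : τ) :
    mapDifferential f v x j = polyDifferential (f j) v x := rfl

/-- The Zariski tangent space at `v` to the closure of the subset `S` of affine space. -/
def tangentAt (S : Set (σ → K)) (v : σ → K) : Submodule K (σ → K) :=
  ⨅ F ∈ vanishingIdeal K S, LinearMap.ker (polyDifferential F v)

theorem mem_tangentAt {S : Set (σ → K)} {v x : σ → K} :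
    x ∈ tangentAt S v ↔ ∀ F ∈ vanishingIdeal K S, polyDifferential F v x = 0 := by
  simp only [tangentAt, Submodule.mem_iInf, LinearMap.mem_ker]

theorem mapDifferential_mem_tangentAt [Fintype τ] {S : Set (σ → K)} {S' : Set (τ → K)}
    {f : τ → MvPolynomial σ K}
    (hf : vanishingIdeal K S' ≤ (vanishingIdeal K S).comap (bind₁ f)) {v x : σ → K}
    (hx : x ∈ tangentAt S v) :
    mapDifferential f v x ∈ tangentAt S' fun j => eval v (f j) :=
  mem_tangentAt.2 fun F hF =>
    (polyDifferential_bind₁ f F v x).symm.trans (mem_tangentAt.1 hx _ (hf hF))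

end Differentials

section Cones

variable {K : Type*} [Field K] {σ : Type}

/-- The affine cone over a subset of projective space, without its vertex. -/
def coneOf (Z : Set (ℙ K (σ → K))) : Set (σ → K) :=
  {v | ∃ hv : v ≠ 0, Projectivization.mk K v hv ∈ Z}

theorem smul_mem_coneOf {Z : Set (ℙ K (σ → K))} {v : σ → K} (hv : v ∈ coneOf Z) {c : K}
    (hc : c ≠ 0) : c • v ∈ coneOf Z := by
  obtain ⟨hv0, hZ⟩ := hv
  exact ⟨smul_ne_zero hc hv0, by rwa [(Projectivization.mk_eq_mk_iff' K _ _ _ hv0).2 ⟨c, rfl⟩]⟩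

theorem idealOf_eq_vanishingIdeal (Z : Set (ℙ K (σ → K))) :
    idealOf Z = vanishingIdeal K (coneOf Z) :=
  Ideal.ext fun _ => ⟨fun h v hv => h v hv.1 hv.2, fun h v hv hZ => h v ⟨hv, hZ⟩⟩

variable {Z : Set (ℙ K (σ → K))} {F : MvPolynomial σ K}

theorem homogeneousComponent_mem_vanishingIdeal_coneOf [Infinite K]
    (hF : F ∈ vanishingIdeal K (coneOf Z)) (d : ℕ) :
    homogeneousComponent d F ∈ vanishingIdeal K (coneOf Z) :=
  fun _ hv => eval_homogeneousComponent_eq_zero (fun _ hc => hF _ (smul_mem_coneOf hv hc)) d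

theorem eval_zero_of_mem_vanishingIdeal_coneOf [Infinite K] (hZ : (coneOf Z).Nonempty)
    (hF : F ∈ vanishingIdeal K (coneOf Z)) : eval 0 F = 0 := by
  obtain ⟨v, hv⟩ := hZ
  have h : eval v (homogeneousComponent 0 F) = 0 :=
    homogeneousComponent_mem_vanishingIdeal_coneOf hF 0 v hv
  rwa [homogeneousComponent_zero, eval_C, ← constantCoeff_eq, ← eval_zero] at h

variable [Fintype σ]

theorem tangentAt_coneOf_le_smul (Z : Set (ℙ K (σ → K))) (v : σ → K) {c : K} (hc : c ≠ 0) :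
    tangentAt (coneOf Z) v ≤ tangentAt (coneOf Z) (c • v) := by
  intro x hx
  let f : σ → MvPolynomial σ K := fun i => C c * X i
  have hf : vanishingIdeal K (coneOf Z) ≤ (vanishingIdeal K (coneOf Z)).comap (bind₁ f) :=
    fun F hF w hw => (eval_bind₁ f F w).trans <| by
      simpa [f, Pi.smul_def] using hF _ (smul_mem_coneOf hw hc)
  have h := mapDifferential_mem_tangentAt hf hx
  have hdf : mapDifferential f v x = c • x := by
    ext i; simp [f, mapDifferential_apply, polyDifferential_apply_eq_eval]
  have hv : (fun i => eval v (f i)) = c • v := by ext i; simp [f]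
  rw [hdf, hv] at h
  exact ((tangentAt (coneOf Z) (c • v)).smul_mem_iff hc).1 h

theorem tangentAt_coneOf_smul (Z : Set (ℙ K (σ → K))) (v : σ → K) {c : K} (hc : c ≠ 0) :
    tangentAt (coneOf Z) (c • v) = tangentAt (coneOf Z) v := by
  refine le_antisymm ?_ (tangentAt_coneOf_le_smul Z v hc)
  simpa only [inv_smul_smul₀ hc] using tangentAt_coneOf_le_smul Z (c • v) (inv_ne_zero hc)

theorem embTangent_mk (Z : Set (ℙ K (σ → K))) (v : σ → K) (hv : v ≠ 0) :
    embTangent Z (Projectivization.mk K v hv) = tangentAt (coneOf Z) v := by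
  obtain ⟨a, ha⟩ := Projectivization.exists_smul_eq_mk_rep K v hv
  rw [embTangent, idealOf_eq_vanishingIdeal, ← ha]
  exact tangentAt_coneOf_smul Z v a.ne_zero

theorem self_mem_tangentAt_coneOf [Infinite K] {v : σ → K} (hv : v ∈ coneOf Z) :
    v ∈ tangentAt (coneOf Z) v := by
  refine mem_tangentAt.2 fun F hF => ?_
  rw [← sum_homogeneousComponent F, polyDifferential_apply_eq_eval, map_sum, map_sum]
  refine Finset.sum_eq_zero fun d _ => ?_
  have hd : eval v (homogeneousComponent d F) = 0 :=
    homogeneousComponent_mem_vanishingIdeal_coneOf hF d v hv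
  rw [← polyDifferential_apply_eq_eval, polyDifferential_self_of_isHomogeneous
    (homogeneousComponent_isHomogeneous d F), hd, mul_zero]

end Cones

section GenericSmoothness

theorem exists_derivation_extension {K A L : Type*} [CommRing K] [CommRing A] [CommRing L]
    [Algebra K A] [Algebra K L] [Algebra A L] [IsScalarTower K A L] [Algebra.FormallyEtale A L]
    (d : Derivation K A L) : ∃ D : Derivation K L L, ∀ a, D (algebraMap A L a) = d a := by
  let l : Ω[L⁄K] →ₗ[L] L := d.liftKaehlerDifferential.liftBaseChange L ∘ₗ
    (KaehlerDifferential.tensorKaehlerEquivOfFormallyEtale K A L).symm.toLinearMap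
  refine ⟨l.compDer (KaehlerDifferential.D K L), fun a => ?_⟩
  simp [l, KaehlerDifferential.tensorKaehlerEquivOfFormallyEtale_symm_D_algebraMap]

section

variable {K L κ : Type*} [Field K] [Field L] [Algebra K L] [CharZero K]

theorem formallyEtale_mvPolynomial_of_isTranscendenceBasis [Algebra (MvPolynomial κ K) L]
    [IsScalarTower K (MvPolynomial κ K) L]
    (hs : IsTranscendenceBasis K fun k => algebraMap (MvPolynomial κ K) L (X k)) :
    Algebra.FormallyEtale (MvPolynomial κ K) L := by
  have haeval : IsScalarTower.toAlgHom K (MvPolynomial κ K) L =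
      aeval fun k => algebraMap (MvPolynomial κ K) L (X k) := by ext; simp
  have : FaithfulSMul (MvPolynomial κ K) L :=
    (faithfulSMul_iff_algebraMap_injective _ _).2 fun _ _ h =>
      hs.1 <| by rw [← haeval]; exact h
  have : Algebra.IsAlgebraic (MvPolynomial κ K) L := by
    have := hs.isAlgebraic
    refine .of_ringHom_of_comp_eq hs.1.aevalEquiv.toRingHom (RingHom.id L)
      hs.1.aevalEquiv.surjective Function.injective_id (RingHom.ext fun F => ?_)
    exact (hs.1.algebraMap_aevalEquiv F).trans (DFunLike.congr_fun haeval F).symm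
  let F := FractionRing (MvPolynomial κ K)
  let _ : Algebra F L := FractionRing.liftAlgebra (MvPolynomial κ K) L
  have : CharZero F := charZero_of_injective_algebraMap (algebraMap K F).injective
  have : Algebra.IsAlgebraic F L :=
    (IsFractionRing.comap_isAlgebraic_iff (A := MvPolynomial κ K)).1 inferInstance
  have : Algebra.FormallyEtale (MvPolynomial κ K) F := .of_isLocalization (nonZeroDivisors _)
  have : Algebra.FormallyEtale F L := .of_isSeparable F L
  exact .comp _ F _

theorem exists_derivation_of_isTranscendenceBasis_X [Algebra (MvPolynomial κ K) L]
    [IsScalarTower K (MvPolynomial κ K) L]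
    (hs : IsTranscendenceBasis K fun k => algebraMap (MvPolynomial κ K) L (X k)) (c : κ → L) :
    ∃ D : Derivation K L L, ∀ k, D (algebraMap (MvPolynomial κ K) L (X k)) = c k := by
  have := formallyEtale_mvPolynomial_of_isTranscendenceBasis hs
  obtain ⟨D, hD⟩ := exists_derivation_extension (mkDerivation K c)
  exact ⟨D, fun k => by rw [hD, mkDerivation_X]⟩

theorem exists_derivation_of_isTranscendenceBasis {s : κ → L} (hs : IsTranscendenceBasis K s)
    (c : κ → L) : ∃ D : Derivation K L L, ∀ k, D (s k) = c k := by
  let _ : Algebra (MvPolynomial κ K) L := (aeval s).toAlgebra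
  have : IsScalarTower K (MvPolynomial κ K) L :=
    .of_algebraMap_eq fun a => by
      rw [RingHom.algebraMap_toAlgebra]; exact ((aeval s).commutes a).symm
  have hX (k : κ) : algebraMap (MvPolynomial κ K) L (X k) = s k := by
    rw [RingHom.algebraMap_toAlgebra]; exact aeval_X s k
  have hs' : IsTranscendenceBasis K fun k => algebraMap (MvPolynomial κ K) L (X k) := by
    simpa only [hX] using hs
  obtain ⟨D, hD⟩ := exists_derivation_of_isTranscendenceBasis_X hs' c
  exact ⟨D, fun k => (congrArg D (hX k)).symm.trans (hD k)⟩

theorem exists_derivation_of_algebraicIndependent {s : κ → L} (hs : AlgebraicIndependent K s)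
    (c : κ → L) : ∃ D : Derivation K L L, ∀ k, D (s k) = c k := by
  obtain ⟨t, hst, ht⟩ := exists_isTranscendenceBasis_superset hs.coe_range
  obtain ⟨D, hD⟩ := exists_derivation_of_isTranscendenceBasis ht fun x => Function.extend s c 0 x
  exact ⟨D, fun k => (hD ⟨s k, hst ⟨k, rfl⟩⟩).trans (hs.injective.extend_apply c 0 k)⟩

end

end GenericSmoothness

section PartialDerivatives

variable {R σ : Type*} [CommSemiring R]

theorem add_single_mem_support_of_mem_support_pderiv {F : MvPolynomial σ R} {i : σ} {m : σ →₀ ℕ}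
    (hm : m ∈ (pderiv i F).support) : m + Finsupp.single i 1 ∈ F.support := by
  rw [mem_support_iff, coeff_pderiv] at hm
  exact mem_support_iff.2 (left_ne_zero_of_mul hm)

theorem pderiv_mem_supported {s : Set σ} {F : MvPolynomial σ R} (hF : F ∈ supported R s) (i : σ) :
    pderiv i F ∈ supported R s := by
  rw [mem_supported] at hF ⊢
  intro j hj
  obtain ⟨m, hm, hjm⟩ := (mem_vars_iff_mem_support j).1 hj
  refine hF ((mem_vars_iff_mem_support j).2
    ⟨_, add_single_mem_support_of_mem_support_pderiv hm, ?_⟩)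
  simp only [Finsupp.mem_support_iff, Finsupp.add_apply] at hjm ⊢
  lia

theorem totalDegree_pderiv_lt {F : MvPolynomial σ R} {i : σ} (h : pderiv i F ≠ 0) :
    (pderiv i F).totalDegree < F.totalDegree := by
  obtain ⟨m, hm, hdeg⟩ := Finset.exists_mem_eq_sup _ (support_nonempty.2 h)
    fun m : σ →₀ ℕ => m.sum fun _ e => e
  have hle := le_totalDegree (add_single_mem_support_of_mem_support_pderiv hm)
  rw [Finsupp.sum_add_index' (fun _ => rfl) (fun _ _ _ => rfl),
    Finsupp.sum_single_index rfl] at hle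
  exact (Nat.lt_succ_of_le hdeg.le).trans_le hle

theorem notMem_vars_of_pderiv_eq_zero [NoZeroDivisors R] [CharZero R] {F : MvPolynomial σ R} {i : σ}
    (h : pderiv i F = 0) : i ∉ F.vars := by
  intro hi
  obtain ⟨m, hm, him⟩ := (mem_vars_iff_mem_support i).1 hi
  have hm' : m - Finsupp.single i 1 + Finsupp.single i 1 = m :=
    tsub_add_cancel_of_le <| Finsupp.single_le_iff.2 <|
      Nat.one_le_iff_ne_zero.2 (Finsupp.mem_support_iff.1 him)
  have hcoeff := congrArg (coeff (m - Finsupp.single i 1)) h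
  rw [coeff_pderiv, hm', coeff_zero] at hcoeff
  exact mul_ne_zero (mem_support_iff.1 hm) (Nat.cast_add_one_ne_zero _) hcoeff

end PartialDerivatives

section GenericTangent

variable {K : Type*} [Field K] {σ : Type} {I : Ideal (MvPolynomial σ K)} {J : Set σ}

theorem exists_pderiv_notMem [CharZero K] {i : σ} (hJ : ∀ F ∈ I, F ∈ supported K J → F = 0)
    (hi : ∃ F ∈ I, F ∈ supported K (insert i J) ∧ F ≠ 0) :
    ∃ F ∈ I, F ∈ supported K (insert i J) ∧ pderiv i F ∉ I := by
  classical
  let p (d : ℕ) : Prop := ∃ F ∈ I, F ∈ supported K (insert i J) ∧ F ≠ 0 ∧ F.totalDegree = d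
  have hp : ∃ d, p d := by
    obtain ⟨F, hF, hs, h0⟩ := hi
    exact ⟨_, F, hF, hs, h0, rfl⟩
  obtain ⟨F, hF, hs, h0, hdeg⟩ := Nat.find_spec hp
  refine ⟨F, hF, hs, fun hder => h0 (hJ F hF ?_)⟩
  have hder0 : pderiv i F = 0 := by
    by_contra hne
    exact Nat.find_min hp ((totalDegree_pderiv_lt hne).trans_eq hdeg)
      ⟨_, hder, pderiv_mem_supported hs i, hne, rfl⟩
  rw [mem_supported] at hs ⊢
  exact fun j hj => (hs hj).resolve_left fun hji =>
    notMem_vars_of_pderiv_eq_zero hder0 (hji ▸ Finset.mem_coe.1 hj)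

theorem card_le_trdeg_of_forall_mem_supported (hI : I ≠ ⊤)
    (hJ : ∀ F ∈ I, F ∈ supported K J → F = 0) :
    Cardinal.lift (Cardinal.mk J) ≤ Algebra.trdeg K (MvPolynomial σ K ⧸ I) := by
  have := Ideal.Quotient.nontrivial_iff.2 hI
  have hli : AlgebraicIndependent K fun j : J => Ideal.Quotient.mk I (X (j : σ)) := by
    refine (injective_iff_map_eq_zero _).2 fun F hF => ?_
    have hmk : aeval (fun j : J => Ideal.Quotient.mk I (X (j : σ))) F =
        Ideal.Quotient.mk I (rename (↑) F) := by
      change _ = Ideal.Quotient.mkₐ K I (rename (↑) F)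
      rw [← AlgHom.comp_apply]
      congr 1
      ext j
      simp
    rw [hmk, Ideal.Quotient.eq_zero_iff_mem] at hF
    have hs : rename (↑) F ∈ supported K J := by
      rw [supported_eq_range_rename]
      exact ⟨F, rfl⟩
    exact rename_injective _ Subtype.val_injective ((hJ _ hF hs).trans (map_zero _).symm)
  simpa using hli.lift_cardinalMk_le_trdeg

theorem exists_maximal_independent_coordinates [Finite σ] (hI : I ≠ ⊤) :
    ∃ J : Set σ, (∀ F ∈ I, F ∈ supported K J → F = 0) ∧
      ∀ i ∉ J, ∃ F ∈ I, F ∈ supported K (insert i J) ∧ F ≠ 0 := by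
  have hempty : ∀ F ∈ I, F ∈ supported K (∅ : Set σ) → F = 0 := by
    intro F hF hs
    rw [supported_empty, Algebra.mem_bot] at hs
    obtain ⟨a, rfl⟩ := hs
    by_contra ha
    have ha0 : a ≠ 0 := fun h => ha (by rw [h, map_zero])
    exact hI (I.eq_top_of_isUnit_mem hF ((isUnit_iff_ne_zero.2 ha0).map (algebraMap _ _)))
  let independent : Set (Set σ) := {J | ∀ F ∈ I, F ∈ supported K J → F = 0}
  obtain ⟨J, hJ, hmax⟩ := (Set.toFinite independent).exists_maximal ⟨∅, hempty⟩
  refine ⟨J, hJ, fun i hi => ?_⟩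
  by_contra! h
  exact hi (hmax h (Set.subset_insert i J) (Set.mem_insert i J))

variable [Fintype σ]

theorem eq_zero_of_polyDifferential_eq_zero {v x : σ → K} {F : σ → MvPolynomial σ K}
    (hs : ∀ i ∉ J, F i ∈ supported K (insert i J)) (hv : ∀ i ∉ J, eval v (pderiv i (F i)) ≠ 0)
    (hx : ∀ i ∉ J, polyDifferential (F i) v x = 0) (hxJ : ∀ j ∈ J, x j = 0) : x = 0 := by
  funext i
  by_cases hi : i ∈ J
  · exact hxJ i hi
  · have hsum := hx i hi
    rw [polyDifferential_apply, Finset.sum_eq_single i] at hsum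
    · exact (mul_eq_zero.1 hsum).resolve_left (hv i hi)
    · intro j _ hji
      by_cases hj : j ∈ J
      · rw [hxJ j hj, mul_zero]
      · rw [pderiv_eq_zero_of_notMem_vars fun hjF =>
          (mem_supported.1 (hs i hi) (Finset.mem_coe.2 hjF)).elim hji hj, map_zero, zero_mul]
    · simp

theorem exists_eval_ne_zero_finrank_tangentAt_le [CharZero K] {S : Set (σ → K)}
    (hS : (vanishingIdeal K S).IsPrime) {d : ℕ}
    (hd : Algebra.trdeg K (MvPolynomial σ K ⧸ vanishingIdeal K S) ≤ d) :
    ∃ G ∉ vanishingIdeal K S, ∀ v, eval v G ≠ 0 → Module.finrank K (tangentAt S v) ≤ d := by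
  classical
  obtain ⟨J, hJ, hmax⟩ := exists_maximal_independent_coordinates hS.ne_top
  have hF (i : σ) : ∃ F, i ∉ J →
      F ∈ vanishingIdeal K S ∧ F ∈ supported K (insert i J) ∧ pderiv i F ∉ vanishingIdeal K S := by
    by_cases hi : i ∈ J
    · exact ⟨0, fun h => (h hi).elim⟩
    · obtain ⟨F, h⟩ := exists_pderiv_notMem hJ (hmax i hi)
      exact ⟨F, fun _ => h⟩
  choose F hF using hF
  have hcard : Fintype.card J ≤ d := by
    have h := (card_le_trdeg_of_forall_mem_supported hS.ne_top hJ).trans hd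
    simpa using h
  refine ⟨∏ i with i ∉ J, pderiv i (F i), fun hG => ?_, fun v hv => ?_⟩
  · obtain ⟨i, hi, hmem⟩ := hS.prod_mem_iff.1 hG
    exact (hF i (Finset.mem_filter.1 hi).2).2.2 hmem
  · rw [map_prod, Finset.prod_ne_zero_iff] at hv
    have hinj : Function.Injective
        ((LinearMap.funLeft K K ((↑) : J → σ)).domRestrict (tangentAt S v)) := by
      refine (injective_iff_map_eq_zero _).2 fun x hx => Subtype.ext ?_
      exact eq_zero_of_polyDifferential_eq_zero (fun i hi => (hF i hi).2.1)
        (fun i hi => hv i (Finset.mem_filter.2 ⟨Finset.mem_univ i, hi⟩))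
        (fun i hi => mem_tangentAt.1 x.2 _ (hF i hi).1) fun j hj => congrFun hx ⟨j, hj⟩
    have h := LinearMap.finrank_le_finrank_of_injective hinj
    rw [Module.finrank_fintype_fun_eq_card] at h
    exact h.trans hcard

end GenericTangent

section GenericImage

variable {K : Type*} [Field K] {σ τ : Type}

theorem eval_derivation_eq_polyDifferential [Fintype σ]
    (D : Derivation K (MvPolynomial σ K) (MvPolynomial σ K)) (F : MvPolynomial σ K) (v : σ → K) :
    eval v (D F) = polyDifferential F v fun i => eval v (D (X i)) := by
  conv_lhs => rw [← aeval_X_left_apply F]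
  rw [derivation_aeval]
  simp [polyDifferential_apply]

theorem exists_derivations_linearIndependent [CharZero K] {L : Type*} [Field L] [Algebra K L]
    [Finite τ] {κ : Type*} [Finite κ] (y : τ → L) {s : κ → L} (hs : AlgebraicIndependent K s)
    (hsy : ∀ k, s k ∈ Algebra.adjoin K (Set.range y)) :
    ∃ D : κ → Derivation K L L, LinearIndependent L fun k j => D k (y j) := by
  classical
  have := Fintype.ofFinite τ
  choose D hD using fun k => exists_derivation_of_algebraicIndependent hs (Pi.single k (1 : L))
  simp only [Algebra.adjoin_range_eq_range_aeval] at hsy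
  choose t ht using hsy
  let g : (τ → L) →ₗ[L] κ → L :=
    LinearMap.pi fun l => ∑ j, aeval y (pderiv j (t l)) • LinearMap.proj j
  have hg (k : κ) : g (fun j => D k (y j)) = Pi.single k (1 : L) := by
    funext l
    rw [← hD k l, ← ht l]
    simp [g, derivation_aeval]
  refine ⟨D, LinearIndependent.of_comp g ?_⟩
  have hcomp : g ∘ (fun k j => D k (y j)) = fun k => Pi.single k (1 : L) := funext hg
  rw [hcomp]
  exact Pi.linearIndependent_single_one κ L

theorem exists_algebraicIndependent_of_le_trdeg {R : Type*} [CommRing R] [IsDomain R]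
    [Algebra K R] {d : ℕ} (hd : (d : Cardinal) ≤ Algebra.trdeg K R) :
    ∃ s : Fin d → R, AlgebraicIndependent K s := by
  obtain ⟨t, ht⟩ := exists_isTranscendenceBasis K R
  rw [← ht.cardinalMk_eq_trdeg] at hd
  obtain ⟨e⟩ : Nonempty (Fin d ↪ t) := by
    rw [← Cardinal.lift_mk_le']
    simpa using hd
  exact ⟨_, ht.1.comp e e.injective⟩

section GenericPoint

variable {I : Ideal (MvPolynomial σ K)} {L : Type*} [Field L]
  [Algebra (MvPolynomial σ K) L] [Algebra (MvPolynomial σ K ⧸ I) L]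
  [IsScalarTower (MvPolynomial σ K) (MvPolynomial σ K ⧸ I) L]
  [IsFractionRing (MvPolynomial σ K ⧸ I) L]

theorem algebraMap_eq_zero_iff_mem {F : MvPolynomial σ K} :
    algebraMap (MvPolynomial σ K) L F = 0 ↔ F ∈ I := by
  rw [IsScalarTower.algebraMap_apply _ (MvPolynomial σ K ⧸ I),
    FaithfulSMul.algebraMap_eq_zero_iff, Ideal.Quotient.algebraMap_eq,
    Ideal.Quotient.eq_zero_iff_mem]

variable [Algebra K L] [IsScalarTower K (MvPolynomial σ K) L]

theorem exists_derivation_lift [Finite σ] [I.IsPrime] (D : Derivation K L L) :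
    ∃ b : L, b ≠ 0 ∧ ∃ D' : Derivation K (MvPolynomial σ K) (MvPolynomial σ K),
      ∀ F, algebraMap _ L (D' F) = b * D (algebraMap _ L F) := by
  have := Fintype.ofFinite σ
  let φ := IsScalarTower.toAlgHom K (MvPolynomial σ K) L
  obtain ⟨b, hb⟩ := IsLocalization.exist_integer_multiples_of_finite
    (nonZeroDivisors (MvPolynomial σ K ⧸ I)) fun i => D (φ (X i))
  have hlift (i : σ) : ∃ ξ, φ ξ = algebraMap _ L (b : MvPolynomial σ K ⧸ I) * D (φ (X i)) := by
    obtain ⟨r, hr⟩ := hb i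
    obtain ⟨ξ, rfl⟩ := Ideal.Quotient.mk_surjective r
    exact ⟨ξ, (IsScalarTower.algebraMap_apply _ (MvPolynomial σ K ⧸ I) _ ξ).trans
      (hr.trans (Algebra.smul_def _ _))⟩
  choose ξ hξ using hlift
  refine ⟨algebraMap _ L (b : MvPolynomial σ K ⧸ I), ?_, mkDerivation K ξ, fun F => ?_⟩
  · exact (IsLocalization.map_units _ b).ne_zero
  · change φ (mkDerivation K ξ F) = _ * D (φ F)
    rw [← aeval_X_left_apply F, derivation_aeval, comp_aeval_apply, derivation_aeval]
    simp only [map_sum, map_mul, mkDerivation_X, hξ, Finset.mul_sum, comp_aeval_apply]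
    exact Finset.sum_congr rfl fun i _ => mul_left_comm _ _ _

theorem exists_algebraicIndependent_mem_adjoin [IsScalarTower K (MvPolynomial σ K ⧸ I) L]
    [I.IsPrime] (f : τ → MvPolynomial σ K) {d : ℕ}
    (hd : (d : Cardinal) ≤ Algebra.trdeg K (MvPolynomial τ K ⧸ I.comap (bind₁ f))) :
    ∃ s : Fin d → L, AlgebraicIndependent K s ∧
      ∀ k, s k ∈ Algebra.adjoin K (Set.range fun j => algebraMap _ L (f j)) := by
  obtain ⟨s, hs⟩ := exists_algebraicIndependent_of_le_trdeg hd
  let g : (MvPolynomial τ K ⧸ I.comap (bind₁ f)) →ₐ[K] L :=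
    (IsScalarTower.toAlgHom K (MvPolynomial σ K ⧸ I) L).comp (Ideal.quotientMapₐ I (bind₁ f) le_rfl)
  have hg : Function.Injective g :=
    (FaithfulSMul.algebraMap_injective (MvPolynomial σ K ⧸ I) L).comp Ideal.quotientMap_injective
  refine ⟨g ∘ s, hs.map' hg, fun k => ?_⟩
  obtain ⟨F, hF⟩ := Ideal.Quotient.mk_surjective (s k)
  have hgF : g (s k) = aeval (fun j => algebraMap _ L (f j)) F := by
    rw [← hF]
    change algebraMap (MvPolynomial σ K ⧸ I) L (Ideal.Quotient.mk I (bind₁ f F)) = _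
    rw [← Ideal.Quotient.algebraMap_eq, ← IsScalarTower.algebraMap_apply, ← aeval_eq_bind₁]
    exact comp_aeval_apply _ (IsScalarTower.toAlgHom K (MvPolynomial σ K) L) F
  rw [Function.comp_apply, hgF, Algebra.adjoin_range_eq_range_aeval]
  exact ⟨F, rfl⟩

theorem exists_derivations_map_mem_linearIndependent [CharZero K] [Finite σ] [Finite τ]
    [IsScalarTower K (MvPolynomial σ K ⧸ I) L] [I.IsPrime] (f : τ → MvPolynomial σ K) {d : ℕ}
    (hd : (d : Cardinal) ≤ Algebra.trdeg K (MvPolynomial τ K ⧸ I.comap (bind₁ f))) :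
    ∃ D : Fin d → Derivation K (MvPolynomial σ K) (MvPolynomial σ K),
      (∀ k, ∀ F ∈ I, D k F ∈ I) ∧
      LinearIndependent L fun k j => algebraMap _ L (D k (f j)) := by
  obtain ⟨s, hs, hsmem⟩ := exists_algebraicIndependent_mem_adjoin (L := L) f hd
  obtain ⟨D, hD⟩ := exists_derivations_linearIndependent _ hs hsmem
  choose b hb D' hD' using fun k => exists_derivation_lift (I := I) (D k)
  refine ⟨D', fun k F hF => ?_, ?_⟩
  · rw [← algebraMap_eq_zero_iff_mem (L := L)] at hF ⊢
    rw [hD', hF, map_zero, mul_zero]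
  · convert hD.units_smul fun k => Units.mk0 (b k) (hb k) using 1
    funext k j
    exact hD' k (f j)

end GenericPoint

theorem exists_derivations_eval_linearIndependent [CharZero K] [Finite σ] [Finite τ]
    {I : Ideal (MvPolynomial σ K)} [I.IsPrime] (f : τ → MvPolynomial σ K)
    {d : ℕ} (hd : (d : Cardinal) ≤ Algebra.trdeg K (MvPolynomial τ K ⧸ I.comap (bind₁ f))) :
    ∃ D : Fin d → Derivation K (MvPolynomial σ K) (MvPolynomial σ K),
      (∀ k, ∀ F ∈ I, D k F ∈ I) ∧
      ∃ G ∉ I, ∀ v, eval v G ≠ 0 → LinearIndependent K fun k j => eval v (D k (f j)) := by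
  obtain ⟨D, hDmem, hD⟩ := exists_derivations_map_mem_linearIndependent
    (L := FractionRing (MvPolynomial σ K ⧸ I)) f hd
  obtain ⟨G, hG, hspec⟩ := exists_linearIndependent_specialization (E := K)
    (fun k j => D k (f j)) _ hD
  exact ⟨D, hDmem, G, fun h => hG (algebraMap_eq_zero_iff_mem.2 h), fun v => hspec (eval v)⟩

theorem exists_eval_ne_zero_le_finrank_map_tangentAt [CharZero K] [Fintype σ] [Finite τ]
    {S : Set (σ → K)} (hS : (vanishingIdeal K S).IsPrime) (f : τ → MvPolynomial σ K) {d : ℕ}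
    (hd : (d : Cardinal) ≤
      Algebra.trdeg K (MvPolynomial τ K ⧸ (vanishingIdeal K S).comap (bind₁ f))) :
    ∃ G ∉ vanishingIdeal K S, ∀ v ∈ S, eval v G ≠ 0 →
      d ≤ Module.finrank K ((tangentAt S v).map (mapDifferential f v)) := by
  obtain ⟨D, hDmem, G, hG, hspec⟩ := exists_derivations_eval_linearIndependent f hd
  refine ⟨G, hG, fun v hv hGv => ?_⟩
  have hvec (k : Fin d) : (fun i => eval v (D k (X i))) ∈ tangentAt S v :=
    mem_tangentAt.2 fun F hF => by
      rw [← eval_derivation_eq_polyDifferential]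
      exact hDmem k F hF v hv
  have himage (k : Fin d) :
      mapDifferential f v (fun i => eval v (D k (X i))) = fun j => eval v (D k (f j)) :=
    funext fun j => (eval_derivation_eq_polyDifferential (D k) (f j) v).symm
  have hli : LinearIndependent K fun k => (⟨_, Submodule.mem_map_of_mem (hvec k)⟩ :
      (tangentAt S v).map (mapDifferential f v)) :=
    .of_comp (Submodule.subtype _) (by
      simpa only [Function.comp_def, Submodule.subtype_apply, himage] using hspec v hGv)
  simpa using hli.fintype_card_le_finrank

end GenericImage

section GeneralLine

variable {K : Type*} [Field K] {N : ℕ} {B : Set (Line K N)}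

/-- The representative `b₀ ∧ b₁` of the Plücker point of `r`, where `b₀, b₁` is the chosen basis
of `r̂`. -/
def plueckerVec (r : Line K N) : PlIdx N → K :=
  wedge (lineBasis r 0 : Vec K N) (lineBasis r 1 : Vec K N)

theorem plueckerVec_ne_zero (r : Line K N) : plueckerVec r ≠ 0 := wedge_lineBasis_ne_zero r

theorem plueckerVec_mem_coneOf {r : Line K N} (hr : r ∈ B) :
    plueckerVec r ∈ coneOf (pluecker '' B) :=
  ⟨plueckerVec_ne_zero r, r, hr, rfl⟩

theorem mem_coneOf_pluecker {q : PlIdx N → K} :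
    q ∈ coneOf (pluecker '' B) ↔ ∃ r ∈ B, ∃ c : K, c ≠ 0 ∧ q = c • plueckerVec r := by
  constructor
  · rintro ⟨hq, r, hr, hrq⟩
    obtain ⟨c, hc⟩ := (Projectivization.mk_eq_mk_iff' K _ _ hq (plueckerVec_ne_zero r)).1 hrq.symm
    exact ⟨r, hr, c, fun h => hq (by rw [← hc, h, zero_smul]), hc.symm⟩
  · rintro ⟨r, hr, c, hc, rfl⟩
    exact smul_mem_coneOf (plueckerVec_mem_coneOf hr) hc

theorem embTangent_pluecker (B : Set (Line K N)) (r : Line K N) :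
    embTangent (pluecker '' B) (pluecker r) = tangentAt (coneOf (pluecker '' B)) (plueckerVec r) :=
  embTangent_mk _ _ (plueckerVec_ne_zero r)

theorem mem_idealOf_pluecker {F : MvPolynomial (PlIdx N) K} :
    F ∈ idealOf (pluecker '' B) ↔ ∀ r ∈ B, ∀ c : K, c ≠ 0 → eval (c • plueckerVec r) F = 0 := by
  rw [idealOf_eq_vanishingIdeal]
  constructor
  · exact fun hF r hr c hc => hF _ (mem_coneOf_pluecker.2 ⟨r, hr, c, hc, rfl⟩)
  · intro h q hq
    obtain ⟨r, hr, c, hc, rfl⟩ := mem_coneOf_pluecker.1 hq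
    exact h r hr c hc

section Homogeneous

variable {F : MvPolynomial (PlIdx N) K} {d : ℕ} (hF : F.IsHomogeneous d)
include hF

theorem eval_rep_pluecker_eq_zero_iff (r : Line K N) :
    eval (pluecker r).rep F = 0 ↔ eval (plueckerVec r) F = 0 := by
  obtain ⟨a, ha⟩ := Projectivization.exists_smul_eq_mk_rep K _ (plueckerVec_ne_zero r)
  have hrep : (pluecker r).rep = (a : K) • plueckerVec r := ha.symm
  rw [hrep, eval_smul_of_isHomogeneous hF, mul_eq_zero_iff_left (pow_ne_zero _ a.ne_zero)]

theorem mem_idealOf_pluecker_iff_of_isHomogeneous :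
    F ∈ idealOf (pluecker '' B) ↔ ∀ r ∈ B, eval (plueckerVec r) F = 0 := by
  simp only [mem_idealOf_pluecker, eval_smul_of_isHomogeneous hF]
  exact ⟨fun h r hr => by simpa using h r hr 1 one_ne_zero,
    fun h r hr c _ => by rw [h r hr, mul_zero]⟩

end Homogeneous

theorem forGeneral_iff_exists_isHomogeneous {P : Line K N → Prop} :
    ForGeneral B P ↔ ∃ (F : MvPolynomial (PlIdx N) K) (d : ℕ), F.IsHomogeneous d ∧
      F ∉ idealOf (pluecker '' B) ∧ ∀ r ∈ B, eval (plueckerVec r) F ≠ 0 → P r := by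
  constructor
  · rintro ⟨C, ⟨S, hS, hC⟩, ⟨r, hr, hrC⟩, hP⟩
    rw [hC] at hrC
    push Not at hrC
    obtain ⟨F, hFS, hFr⟩ := hrC
    obtain ⟨d, hF⟩ := hS F hFS
    rw [Ne, eval_rep_pluecker_eq_zero_iff hF] at hFr
    refine ⟨F, d, hF, fun h => hFr ((mem_idealOf_pluecker_iff_of_isHomogeneous hF).1 h r hr),
      fun s hs hFs => hP s hs fun hsC => hFs ?_⟩
    exact (eval_rep_pluecker_eq_zero_iff hF s).1 ((hC _).1 hsC F hFS)
  · rintro ⟨F, d, hF, hFB, hP⟩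
    rw [mem_idealOf_pluecker_iff_of_isHomogeneous hF] at hFB
    push Not at hFB
    obtain ⟨r, hr, hFr⟩ := hFB
    refine ⟨{x | eval x.rep F = 0}, ⟨{F}, ?_, fun x => ?_⟩, ⟨r, hr, ?_⟩, fun s hs hFs => hP s hs ?_⟩
    · rintro _ rfl
      exact ⟨d, hF⟩
    · simp only [Set.mem_ofPred_eq, Set.mem_singleton_iff, forall_eq]
    · exact fun h => hFr ((eval_rep_pluecker_eq_zero_iff hF r).1 h)
    · exact fun h => hFs ((eval_rep_pluecker_eq_zero_iff hF s).2 h)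

variable {P Q : Line K N → Prop}

theorem ForGeneral.exists (h : ForGeneral B P) : ∃ r ∈ B, P r := by
  obtain ⟨C, _, ⟨r, hr, hrC⟩, hP⟩ := h
  exact ⟨r, hr, hP r hr hrC⟩

theorem ForGeneral.mono (h : ForGeneral B P) (hPQ : ∀ r ∈ B, P r → Q r) : ForGeneral B Q := by
  obtain ⟨C, hC, hex, hP⟩ := h
  exact ⟨C, hC, hex, fun r hr hrC => hPQ r hr (hP r hr hrC)⟩

theorem ForGeneral.and (hB : (idealOf (pluecker '' B)).IsPrime) (hP : ForGeneral B P)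
    (hQ : ForGeneral B Q) : ForGeneral B fun r => P r ∧ Q r := by
  rw [forGeneral_iff_exists_isHomogeneous] at hP hQ ⊢
  obtain ⟨F, d, hF, hFB, hP⟩ := hP
  obtain ⟨G, e, hG, hGB, hQ⟩ := hQ
  refine ⟨F * G, d + e, hF.mul hG, fun h => (hB.mem_or_mem h).elim hFB hGB, fun r hr hFG => ?_⟩
  rw [map_mul] at hFG
  exact ⟨hP r hr (left_ne_zero_of_mul hFG), hQ r hr (right_ne_zero_of_mul hFG)⟩

theorem ForGeneral.congr (hB : (idealOf (pluecker '' B)).IsPrime) {R : Line K N → Prop}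
    (hR : ForGeneral B R) (h : ∀ r ∈ B, R r → (P r ↔ Q r)) : ForGeneral B P ↔ ForGeneral B Q :=
  ⟨fun hP => (hR.and hB hP).mono fun r hr hRP => (h r hr hRP.1).1 hRP.2,
    fun hQ => (hR.and hB hQ).mono fun r hr hRQ => (h r hr hRQ.1).2 hRQ.2⟩

theorem forGeneral_of_forall (hB : idealOf (pluecker '' B) ≠ ⊤) (h : ∀ r ∈ B, P r) :
    ForGeneral B P :=
  forGeneral_iff_exists_isHomogeneous.2 ⟨1, 0, isHomogeneous_one _ _,
    fun h1 => hB ((Ideal.eq_top_iff_one _).2 h1), fun r hr _ => h r hr⟩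

theorem forGeneral_of_eval_ne_zero [Infinite K] {F : MvPolynomial (PlIdx N) K}
    (hF : F ∉ idealOf (pluecker '' B))
    (h : ∀ r ∈ B, ∀ c : K, c ≠ 0 → eval (c • plueckerVec r) F ≠ 0 → P r) : ForGeneral B P := by
  obtain ⟨d, hd⟩ : ∃ d, homogeneousComponent d F ∉ idealOf (pluecker '' B) := by
    by_contra! hall
    exact hF (sum_homogeneousComponent F ▸ Ideal.sum_mem _ fun d _ => hall d)
  refine forGeneral_iff_exists_isHomogeneous.2
    ⟨_, d, homogeneousComponent_isHomogeneous d F, hd, fun r hr hFr => ?_⟩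
  by_contra hPr
  refine hFr (eval_homogeneousComponent_eq_zero (fun c hc => ?_) d)
  by_contra hne
  exact hPr (h r hr c hc hne)

end GeneralLine

section PlueckerTangent

variable {K : Type*} [Field K] {N : ℕ}

/-- The matrix-vector product, for a point of the Plücker space seen as a matrix. -/
def act : (PlIdx N → K) →ₗ[K] Vec K N →ₗ[K] Vec K N :=
  LinearMap.mk₂ K (fun p w i => ∑ j, p (i, j) * w j)
    (fun _ _ _ => by ext; simp [add_mul, Finset.sum_add_distrib])
    (fun _ _ _ => by ext; simp [Finset.mul_sum, mul_assoc])
    (fun _ _ _ => by ext; simp [mul_add, Finset.sum_add_distrib])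
    (fun _ _ _ => by ext; simp [Finset.mul_sum, mul_left_comm])

theorem act_apply (p : PlIdx N → K) (w : Vec K N) (i : Fin (N + 1)) :
    act p w i = ∑ j, p (i, j) * w j := rfl

theorem act_single (p : PlIdx N → K) (i j : Fin (N + 1)) :
    act p (Pi.single j 1) i = p (i, j) := by
  simp [act_apply, Pi.single_apply]

theorem act_wedge (u v w : Vec K N) :
    act (wedge u v) w = (v ⬝ᵥ w) • u - (u ⬝ᵥ w) • v := by
  ext i
  simp only [act_apply, wedge_apply, sub_mul, Finset.sum_sub_distrib, Pi.sub_apply, Pi.smul_apply,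
    smul_eq_mul, dotProduct, Finset.sum_mul]
  congr 1 <;> exact Finset.sum_congr rfl fun j _ => by ring

theorem act_wedge_single_sub_single (u v : Vec K N) (s t : K) (a b : Fin (N + 1)) :
    act (wedge u v) ((s • u + t • v) a • Pi.single b 1 - (s • u + t • v) b • Pi.single a 1) =
      wedge u v (a, b) • (s • u + t • v) := by
  ext i
  simp only [map_sub, map_smul, Pi.sub_apply, Pi.smul_apply, Pi.add_apply, act_single, wedge_apply,
    smul_eq_mul]
  ring

theorem act_plueckerVec_mem (r : Line K N) (w : Vec K N) : act (plueckerVec r) w ∈ r.1 := by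
  rw [plueckerVec, act_wedge]
  exact sub_mem (r.1.smul_mem _ (lineBasis r 0).2) (r.1.smul_mem _ (lineBasis r 1).2)

theorem range_act_plueckerVec (r : Line K N) : LinearMap.range (act (plueckerVec r)) = r.1 := by
  refine le_antisymm (LinearMap.range_le_iff_comap.2 <| Submodule.eq_top_iff'.2 fun w =>
    act_plueckerVec_mem r w) fun x hx => ?_
  obtain ⟨⟨a, b⟩, hab⟩ := Function.ne_iff.1 (plueckerVec_ne_zero r)
  have hx' : _ = x := congrArg Subtype.val ((lineBasis r).sum_repr ⟨x, hx⟩)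
  rw [Fin.sum_univ_two, Submodule.coe_add, Submodule.coe_smul, Submodule.coe_smul] at hx'
  rw [← (LinearMap.range _).smul_mem_iff hab, ← hx']
  exact ⟨_, act_wedge_single_sub_single ..⟩

theorem plueckerDifferential_apply (r : Line K N) (A : r.1 →ₗ[K] Vec K N) :
    plueckerDifferential r A = wedge (lineBasis r 0 : Vec K N) (A (lineBasis r 1)) +
      wedge (A (lineBasis r 0)) (lineBasis r 1 : Vec K N) := rfl

theorem mkQ_act_plueckerDifferential (r : Line K N) (A : r.1 →ₗ[K] Vec K N) (w : Vec K N) :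
    r.1.mkQ (act (plueckerDifferential r A) w) =
      r.1.mkQ (A ⟨act (plueckerVec r) w, act_plueckerVec_mem r w⟩) := by
  have hw : (⟨act (plueckerVec r) w, act_plueckerVec_mem r w⟩ : r.1) =
      ((lineBasis r 1 : Vec K N) ⬝ᵥ w) • lineBasis r 0 -
        ((lineBasis r 0 : Vec K N) ⬝ᵥ w) • lineBasis r 1 :=
    Subtype.ext (act_wedge ..)
  have hmkQ (i : Fin 2) : r.1.mkQ (lineBasis r i : Vec K N) = 0 :=
    (Submodule.Quotient.mk_eq_zero _).2 (lineBasis r i).2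
  rw [hw, plueckerDifferential_apply, map_add, LinearMap.add_apply, act_wedge, act_wedge]
  simp only [map_add, map_sub, map_smul, hmkQ, smul_zero]
  abel

theorem pluecker_relation_of_mem_tangentAt {B : Set (Line K N)} {p ξ : PlIdx N → K}
    (hξ : ξ ∈ tangentAt (coneOf (pluecker '' B)) p) (i j a b : Fin (N + 1)) :
    ξ (i, j) * p (a, b) + p (i, j) * ξ (a, b) - ξ (i, a) * p (j, b) - p (i, a) * ξ (j, b) +
      ξ (i, b) * p (j, a) + p (i, b) * ξ (j, a) = 0 := by
  have hF : (X (i, j) * X (a, b) - X (i, a) * X (j, b) + X (i, b) * X (j, a) :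
      MvPolynomial (PlIdx N) K) ∈ vanishingIdeal K (coneOf (pluecker '' B)) := by
    rw [← idealOf_eq_vanishingIdeal, mem_idealOf_pluecker]
    intro r _ c _
    simp only [map_add, map_sub, map_mul, eval_X, Pi.smul_apply, smul_eq_mul, plueckerVec,
      wedge_apply]
    ring
  have h := mem_tangentAt.1 hξ _ hF
  rw [polyDifferential_apply_eq_eval] at h
  simp only [map_add, map_sub, Derivation.leibniz, mkDerivation_X, smul_eq_mul, map_mul, eval_X,
    eval_C] at h
  linear_combination h

-- Solving the differentiated Plücker relations with `p (a, b) ≠ 0` gives the witness.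
theorem exists_plueckerDifferential_eq {B : Set (Line K N)} {r : Line K N} {ξ : PlIdx N → K}
    (hξ : ξ ∈ tangentAt (coneOf (pluecker '' B)) (plueckerVec r)) :
    ∃ A, plueckerDifferential r A = ξ := by
  obtain ⟨⟨a, b⟩, hab⟩ := Function.ne_iff.1 (plueckerVec_ne_zero r)
  set u : Vec K N := ((lineBasis r 0 : r.1) : Vec K N)
  set v : Vec K N := ((lineBasis r 1 : r.1) : Vec K N)
  refine ⟨(lineBasis r).constr K ![
    (plueckerVec r (a, b))⁻¹ • ((fun i => u a * ξ (i, b) - u b * ξ (i, a)) - ξ (a, b) • u),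
    (plueckerVec r (a, b))⁻¹ • (fun i => v a * ξ (i, b) - v b * ξ (i, a))], ?_⟩
  rw [plueckerDifferential_apply, Module.Basis.constr_basis, Module.Basis.constr_basis]
  ext ⟨i, j⟩
  have h := pluecker_relation_of_mem_tangentAt hξ i j a b
  apply mul_left_cancel₀ hab
  simp only [Matrix.cons_val_zero, Matrix.cons_val_one, map_smul, LinearMap.smul_apply,
    Pi.add_apply, Pi.smul_apply, smul_eq_mul, mul_add, mul_inv_cancel_left₀ hab]
  simp only [plueckerVec, wedge_apply, Pi.sub_apply, Pi.smul_apply, smul_eq_mul] at h ⊢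
  linear_combination -h

theorem exists_map_tangentAt_eq_tangentSpace (B : Set (Line K N)) (r : Line K N) :
    ∃ Ψ : (PlIdx N → K) →ₗ[K] r.1 →ₗ[K] Vec K N ⧸ r.1,
      (tangentAt (coneOf (pluecker '' B)) (plueckerVec r)).map Ψ = tangentSpace B r ∧
      (∀ ξ ∈ tangentAt (coneOf (pluecker '' B)) (plueckerVec r), ∀ w,
        Ψ ξ ⟨act (plueckerVec r) w, act_plueckerVec_mem r w⟩ = r.1.mkQ (act ξ w)) ∧
      Ψ (plueckerVec r) = 0 := by
  obtain ⟨s, hs⟩ := LinearMap.exists_rightInverse_of_surjective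
    ((act (plueckerVec r)).codRestrict r.1 (act_plueckerVec_mem r)) (by
      rw [LinearMap.range_codRestrict, range_act_plueckerVec, Submodule.comap_subtype_self])
  let Ψ : (PlIdx N → K) →ₗ[K] r.1 →ₗ[K] Vec K N ⧸ r.1 :=
    LinearMap.compRight K r.1.mkQ ∘ₗ LinearMap.lcomp K (Vec K N) s ∘ₗ act
  have hΨ (A : r.1 →ₗ[K] Vec K N) :
      Ψ (plueckerDifferential r A) = LinearMap.compRight K r.1.mkQ A :=
    LinearMap.ext fun v => (mkQ_act_plueckerDifferential r A (s v)).trans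
      (congrArg (fun x => r.1.mkQ (A x)) (LinearMap.congr_fun hs v))
  refine ⟨Ψ, ?_, fun ξ hξ w => ?_, LinearMap.ext fun v => ?_⟩
  · rw [tangentSpace, embTangent_pluecker]
    ext θ
    constructor
    · rintro ⟨ξ, hξ, rfl⟩
      obtain ⟨A, rfl⟩ := exists_plueckerDifferential_eq hξ
      exact ⟨A, hξ, (hΨ A).symm⟩
    · rintro ⟨A, hA, rfl⟩
      exact ⟨_, hA, hΨ A⟩
  · obtain ⟨A, rfl⟩ := exists_plueckerDifferential_eq hξ
    rw [hΨ, mkQ_act_plueckerDifferential]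
    rfl
  · exact (Submodule.Quotient.mk_eq_zero _).2 (act_plueckerVec_mem r _)

theorem finrank_tangentSpace_lt [Infinite K] {B : Set (Line K N)} {r : Line K N} (hr : r ∈ B) :
    Module.finrank K (tangentSpace B r) <
      Module.finrank K (tangentAt (coneOf (pluecker '' B)) (plueckerVec r)) := by
  obtain ⟨Ψ, hmap, -, hΨ⟩ := exists_map_tangentAt_eq_tangentSpace B r
  rw [← hmap, ← LinearMap.range_domRestrict, ← LinearMap.finrank_range_add_finrank_ker
    (Ψ.domRestrict (tangentAt (coneOf (pluecker '' B)) (plueckerVec r)))]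
  refine Nat.lt_add_of_pos_right (Submodule.one_le_finrank_iff.2 <| (Submodule.ne_bot_iff _).2
    ⟨⟨_, self_mem_tangentAt_coneOf (plueckerVec_mem_coneOf hr)⟩, hΨ, fun h => ?_⟩)
  exact plueckerVec_ne_zero r (congrArg Subtype.val h)

/-- The evaluation `T_r B → V / r̂`, `η ↦ η v`, as a linear function of `v ∈ r̂`; up to sign, it is
the characteristic map at `v`. -/
def evalTangent (B : Set (Line K N)) (r : Line K N) :
    r.1 →ₗ[K] tangentSpace B r →ₗ[K] Vec K N ⧸ r.1 :=
  (tangentSpace B r).subtype.flip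

theorem mkQ_act_mem_range_evalTangent {B : Set (Line K N)} {r : Line K N} {ξ : PlIdx N → K}
    (hξ : ξ ∈ tangentAt (coneOf (pluecker '' B)) (plueckerVec r)) (w : Vec K N) :
    r.1.mkQ (act ξ w) ∈ LinearMap.range
      (evalTangent B r ⟨act (plueckerVec r) w, act_plueckerVec_mem r w⟩) := by
  obtain ⟨Ψ, hmap, hΨ, -⟩ := exists_map_tangentAt_eq_tangentSpace B r
  exact ⟨⟨Ψ ξ, hmap ▸ Submodule.mem_map_of_mem hξ⟩, hΨ ξ hξ w⟩

end PlueckerTangent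

section ProductIdeal

variable {K : Type*} [Field K] {σ τ : Type}

theorem vanishingIdeal_univ [Infinite K] :
    vanishingIdeal K (Set.univ : Set (σ → K)) = ⊥ :=
  eq_bot_iff.2 fun _ hF =>
    MvPolynomial.funext fun x => (hF x (Set.mem_univ x)).trans (map_zero _).symm

theorem eval_bind₁_elim_X_C (F : MvPolynomial (σ ⊕ τ) K) (p : σ → K) (w : τ → K) :
    eval p (bind₁ (Sum.elim X fun j => C (w j)) F) = eval (Sum.elim p w) F := by
  rw [eval_bind₁]
  congr 2
  ext (i | j) <;> simp

theorem eval_bind₁_elim_C_X (F : MvPolynomial (σ ⊕ τ) K) (p : σ → K) (w : τ → K) :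
    eval w (bind₁ (Sum.elim (fun i => C (p i)) X) F) = eval (Sum.elim p w) F := by
  rw [eval_bind₁]
  congr 2
  ext (i | j) <;> simp

theorem notMem_vanishingIdeal {S : Set (σ → K)} {F : MvPolynomial σ K} :
    F ∉ vanishingIdeal K S ↔ ∃ v ∈ S, eval v F ≠ 0 := by
  rw [mem_vanishingIdeal_iff]
  push Not
  rfl

/-- The product of two subsets of affine spaces. -/
def prodSet (S : Set (σ → K)) (T : Set (τ → K)) : Set (σ ⊕ τ → K) :=
  {z | z ∘ Sum.inl ∈ S ∧ z ∘ Sum.inr ∈ T}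

theorem notMem_vanishingIdeal_prodSet {S : Set (σ → K)} {T : Set (τ → K)}
    {F : MvPolynomial (σ ⊕ τ) K} :
    F ∉ vanishingIdeal K (prodSet S T) ↔ ∃ p ∈ S, ∃ w ∈ T, eval (Sum.elim p w) F ≠ 0 := by
  rw [notMem_vanishingIdeal]
  constructor
  · rintro ⟨z, ⟨hS, hT⟩, hz⟩
    exact ⟨_, hS, _, hT, by rwa [Sum.elim_comp_inl_inr]⟩
  · rintro ⟨p, hp, w, hw, h⟩
    exact ⟨Sum.elim p w, ⟨hp, hw⟩, h⟩

theorem isPrime_vanishingIdeal_prodSet {S : Set (σ → K)} {T : Set (τ → K)}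
    (hS : (vanishingIdeal K S).IsPrime) (hT : (vanishingIdeal K T).IsPrime) :
    (vanishingIdeal K (prodSet S T)).IsPrime := by
  refine ⟨fun h => ?_, fun {F G} hFG => ?_⟩
  · obtain ⟨p, hp, -⟩ := notMem_vanishingIdeal.1 ((Ideal.ne_top_iff_one _).1 hS.ne_top)
    obtain ⟨w, hw, -⟩ := notMem_vanishingIdeal.1 ((Ideal.ne_top_iff_one _).1 hT.ne_top)
    exact notMem_vanishingIdeal_prodSet.2 ⟨p, hp, w, hw, by simp⟩
      ((Ideal.eq_top_iff_one _).1 h)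
  · by_contra! h
    obtain ⟨p, hp, w, hw, hF⟩ := notMem_vanishingIdeal_prodSet.1 h.1
    obtain ⟨p', hp', w', hw', hG⟩ := notMem_vanishingIdeal_prodSet.1 h.2
    rw [← eval_bind₁_elim_X_C] at hF hG
    obtain ⟨q, hq, hFG'⟩ := notMem_vanishingIdeal.1 <| hS.mul_notMem
      (notMem_vanishingIdeal.2 ⟨p, hp, hF⟩) (notMem_vanishingIdeal.2 ⟨p', hp', hG⟩)
    rw [map_mul, eval_bind₁_elim_X_C, eval_bind₁_elim_X_C, ← eval_bind₁_elim_C_X,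
      ← eval_bind₁_elim_C_X] at hFG'
    obtain ⟨w₁, hw₁, hne⟩ := notMem_vanishingIdeal.1 <| hT.mul_notMem
      (notMem_vanishingIdeal.2 ⟨w, hw, left_ne_zero_of_mul hFG'⟩)
      (notMem_vanishingIdeal.2 ⟨w', hw', right_ne_zero_of_mul hFG'⟩)
    rw [← map_mul, eval_bind₁_elim_C_X] at hne
    exact notMem_vanishingIdeal_prodSet.2 ⟨q, hq, w₁, hw₁, hne⟩ hFG

end ProductIdeal

section Incidence

variable {K : Type*} [Field K] {N : ℕ} {B : Set (Line K N)}

theorem mem_coneOf_unionOfLines {v : Vec K N} :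
    v ∈ coneOf (unionOfLines B) ↔ v ≠ 0 ∧ ∃ r ∈ B, v ∈ r.1 := by
  simp only [coneOf, unionOfLines, Set.mem_ofPred_eq, Projectivization.submodule_mk,
    Submodule.span_singleton_le_iff_mem, exists_prop]

/-- The product of the cone over `B` and `V`. It parametrizes the points of the lines of `B`
by `(q, w) ↦ act q w`. -/
def incidenceCone (B : Set (Line K N)) : Set (PlIdx N ⊕ Fin (N + 1) → K) :=
  prodSet (coneOf (pluecker '' B)) Set.univ

/-- The components of the polynomial map `(q, w) ↦ act q w`. -/
def actPoly (i : Fin (N + 1)) : MvPolynomial (PlIdx N ⊕ Fin (N + 1)) K :=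
  ∑ j, X (Sum.inl (i, j)) * X (Sum.inr j)

theorem eval_actPoly (z : PlIdx N ⊕ Fin (N + 1) → K) :
    (fun i => eval z (actPoly i)) = act (z ∘ Sum.inl) (z ∘ Sum.inr) := by
  ext i
  simp [actPoly, act_apply]

theorem mapDifferential_actPoly (z ζ : PlIdx N ⊕ Fin (N + 1) → K) :
    mapDifferential actPoly z ζ =
      act (ζ ∘ Sum.inl) (z ∘ Sum.inr) + act (z ∘ Sum.inl) (ζ ∘ Sum.inr) := by
  ext i
  simp [mapDifferential_apply, polyDifferential_apply_eq_eval, actPoly, act_apply,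
    Finset.sum_add_distrib, add_comm, mul_comm]

theorem comp_inl_mem_tangentAt {z ζ : PlIdx N ⊕ Fin (N + 1) → K}
    (hζ : ζ ∈ tangentAt (incidenceCone B) z) :
    ζ ∘ Sum.inl ∈ tangentAt (coneOf (pluecker '' B)) (z ∘ Sum.inl) := by
  have h := mapDifferential_mem_tangentAt (S' := coneOf (pluecker '' B))
    (f := fun p => X (Sum.inl p)) (fun F hF y hy => (eval_bind₁ _ F y).trans <| by
      simp only [eval_X]
      exact hF _ hy.1) hζ
  have hd : mapDifferential (fun p => X (Sum.inl p)) z ζ = ζ ∘ Sum.inl := by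
    ext p
    simp [mapDifferential_apply, polyDifferential_apply_eq_eval]
  simp only [hd, eval_X] at h
  exact h

theorem act_smul_plueckerVec_mem (r : Line K N) (c : K) (w : Vec K N) :
    act (c • plueckerVec r) w ∈ r.1 := by
  rw [map_smul]
  exact r.1.smul_mem c (act_plueckerVec_mem r w)

theorem comap_vanishingIdeal_incidenceCone [Infinite K] (B : Set (Line K N)) :
    (vanishingIdeal K (incidenceCone B)).comap (bind₁ actPoly) = idealOf (unionOfLines B) := by
  ext F
  rw [Ideal.mem_comap, idealOf_eq_vanishingIdeal]
  constructor
  · intro hF v hv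
    obtain ⟨-, r, hr, hvr⟩ := mem_coneOf_unionOfLines.1 hv
    rw [← range_act_plueckerVec r] at hvr
    obtain ⟨w, rfl⟩ := hvr
    have h := (eval_bind₁ actPoly F (Sum.elim (plueckerVec r) w)).symm.trans
      (hF _ ⟨plueckerVec_mem_coneOf hr, Set.mem_univ _⟩)
    rwa [eval_actPoly] at h
  · rintro hF z ⟨hz, -⟩
    obtain ⟨r, hr, c, -, hzr⟩ := mem_coneOf_pluecker.1 hz
    have hmem := act_smul_plueckerVec_mem r c (z ∘ Sum.inr)
    refine (eval_bind₁ _ F z).trans ?_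
    rw [eval_actPoly, hzr]
    by_cases h0 : act (c • plueckerVec r) (z ∘ Sum.inr) = 0
    · rw [h0]
      have hb : (lineBasis r 0 : Vec K N) ≠ 0 :=
        fun h => (lineBasis r).ne_zero 0 (Subtype.ext h)
      exact eval_zero_of_mem_vanishingIdeal_coneOf
        ⟨_, mem_coneOf_unionOfLines.2 ⟨hb, r, hr, (lineBasis r 0).2⟩⟩ hF
    · exact hF _ (mem_coneOf_unionOfLines.2 ⟨h0, r, hr, hmem⟩)

theorem isPrime_vanishingIdeal_incidenceCone [Infinite K]
    (hB : (idealOf (pluecker '' B)).IsPrime) : (vanishingIdeal K (incidenceCone B)).IsPrime := by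
  refine isPrime_vanishingIdeal_prodSet (idealOf_eq_vanishingIdeal (pluecker '' B) ▸ hB) ?_
  rw [vanishingIdeal_univ]
  exact Ideal.isPrime_bot

theorem map_tangentAt_incidenceCone_le (B : Set (Line K N)) (r : Line K N) {c : K} (hc : c ≠ 0)
    (w : Vec K N) :
    (tangentAt (incidenceCone B) (Sum.elim (c • plueckerVec r) w)).map (mapDifferential actPoly
      (Sum.elim (c • plueckerVec r) w)) ≤
      (LinearMap.range (evalTangent B r ⟨act (plueckerVec r) w, act_plueckerVec_mem r w⟩)).comap
        r.1.mkQ := by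
  rintro _ ⟨ζ, hζ, rfl⟩
  have h := comp_inl_mem_tangentAt hζ
  rw [Sum.elim_comp_inl, tangentAt_coneOf_smul _ _ hc] at h
  have h0 : r.1.mkQ (act (c • plueckerVec r) (ζ ∘ Sum.inr)) = 0 :=
    (Submodule.Quotient.mk_eq_zero _).2 (act_smul_plueckerVec_mem r c _)
  rw [Submodule.mem_comap, mapDifferential_actPoly, Sum.elim_comp_inl, Sum.elim_comp_inr, map_add,
    h0, add_zero]
  exact mkQ_act_mem_range_evalTangent h w

theorem map_tangentAt_incidenceCone_le_tangentAt [Infinite K] (B : Set (Line K N))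
    (z : PlIdx N ⊕ Fin (N + 1) → K) :
    (tangentAt (incidenceCone B) z).map (mapDifferential actPoly z) ≤
      tangentAt (coneOf (unionOfLines B)) (act (z ∘ Sum.inl) (z ∘ Sum.inr)) := by
  rintro _ ⟨ζ, hζ, rfl⟩
  rw [← eval_actPoly]
  refine mapDifferential_mem_tangentAt ?_ hζ
  rw [← idealOf_eq_vanishingIdeal, ← comap_vanishingIdeal_incidenceCone]

end Incidence

section GeneralLines

theorem finrank_comap_mkQ {K V : Type*} [DivisionRing K] [AddCommGroup V] [Module K V]
    [FiniteDimensional K V] (S : Submodule K V) (T : Submodule K (V ⧸ S)) :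
    Module.finrank K (T.comap S.mkQ) = Module.finrank K T + Module.finrank K S := by
  rw [← LinearMap.finrank_range_add_finrank_ker (S.mkQ.domRestrict (T.comap S.mkQ)),
    LinearMap.range_domRestrict, Submodule.map_comap_eq_of_surjective S.mkQ_surjective,
    LinearMap.ker_domRestrict, Submodule.ker_mkQ]
  exact congrArg _ (Submodule.submoduleOfEquivOfLe (Submodule.le_comap_mkQ S T)).finrank_eq

theorem vanishingIdeal_image_eval_ne_zero {K : Type*} [Field K] [Infinite K] {σ τ : Type}
    [Finite τ] {L : (τ → K) →ₗ[K] σ → K} (hL : Function.Surjective L) {G : MvPolynomial τ K}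
    (hG : G ≠ 0) :
    vanishingIdeal K (L '' {w | eval w G ≠ 0}) = ⊥ := by
  classical
  have := Fintype.ofFinite τ
  refine eq_bot_iff.2 fun D hD => MvPolynomial.funext fun x => ?_
  have hDG : bind₁ L.toMatrix'.toMvPolynomial D * G = 0 := MvPolynomial.funext fun w => by
    rw [map_mul, eval_bind₁, eval_toMvPolynomial_toMatrix', map_zero, mul_eq_zero]
    exact or_iff_not_imp_right.2 fun hw => hD _ ⟨w, hw, rfl⟩
  obtain ⟨w, rfl⟩ := hL x
  rw [← eval_toMvPolynomial_toMatrix', ← eval_bind₁, (mul_eq_zero.1 hDG).resolve_right hG, map_zero,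
    map_zero]

variable {K : Type*} [Field K] {n N : ℕ} {B : Set (Line K N)} {r : Line K N}

/-- The vector `v ∈ r̂` represents a general point of the union `X` of the lines of `B`, where
`dim X = n + 1`: a nonsingular point at which the tangent space to the cone over `X` is the image
of the tangent space to the incidence correspondence. -/
structure IsGeneralPoint (n : ℕ) (B : Set (Line K N)) (r : Line K N) (v : r.1) : Prop where
  ne_zero : (v : Vec K N) ≠ 0
  finrank_tangentAt :
    Module.finrank K (tangentAt (coneOf (unionOfLines B)) (v : Vec K N)) = n + 2
  tangentAt_eq : tangentAt (coneOf (unionOfLines B)) (v : Vec K N) =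
    (LinearMap.range (evalTangent B r v)).comap r.1.mkQ

/-- The vector of `r̂` with given coordinates in the chosen basis. -/
def lineVec (r : Line K N) : (Fin 2 → K) ≃ₗ[K] r.1 := (lineBasis r).equivFun.symm

/-- The linear map sending `w` to the coordinates of `act (plueckerVec r) w` on `r̂`. -/
def lineCoord (r : Line K N) : Vec K N →ₗ[K] Fin 2 → K :=
  (lineVec r).symm.toLinearMap ∘ₗ
    (act (plueckerVec r)).codRestrict r.1 (act_plueckerVec_mem r)

theorem lineVec_lineCoord (r : Line K N) (w : Vec K N) :
    lineVec r (lineCoord r w) = ⟨act (plueckerVec r) w, act_plueckerVec_mem r w⟩ :=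
  (lineVec r).apply_symm_apply _

theorem lineCoord_surjective (r : Line K N) : Function.Surjective (lineCoord r) := by
  refine (lineVec r).symm.surjective.comp fun v => ?_
  obtain ⟨w, hw⟩ := (range_act_plueckerVec r).ge v.2
  exact ⟨w, Subtype.ext hw⟩

/-- The line `r` is general in the `n`-dimensional family `B`: the family is smooth at `r`, and
the general points of `X` are Zariski dense on `r`. -/
structure IsGeneralLine (n : ℕ) (B : Set (Line K N)) (r : Line K N) : Prop where
  finrank_tangentSpace : Module.finrank K (tangentSpace B r) = n
  vanishingIdeal_eq_bot : vanishingIdeal K {x | IsGeneralPoint n B r (lineVec r x)} = ⊥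

theorem IsGeneralPoint.finrank_range_evalTangent {v : r.1} (h : IsGeneralPoint n B r v) :
    Module.finrank K (LinearMap.range (evalTangent B r v)) = n := by
  have hdim := h.finrank_tangentAt
  rw [h.tangentAt_eq, finrank_comap_mkQ, r.2] at hdim
  exact Nat.add_right_cancel hdim

theorem IsGeneralPoint.le_finrank_tangentSpace {v : r.1} (h : IsGeneralPoint n B r v) :
    n ≤ Module.finrank K (tangentSpace B r) :=
  h.finrank_range_evalTangent.ge.trans (LinearMap.finrank_range_le _)

theorem exists_X_notMem_idealOf {σ : Type} {Z : Set (ℙ K (σ → K))} (hZ : idealOf Z ≠ ⊤) :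
    ∃ i, X i ∉ idealOf Z := by
  by_contra! hX
  refine hZ ((Ideal.eq_top_iff_one _).2 fun v hv hZv => (hv ?_).elim)
  ext i
  simpa using hX i v hv hZv

variable [CharZero K]

theorem exists_isGeneralPoint_of_eval_ne_zero (hB : (idealOf (pluecker '' B)).IsPrime)
    (hX : HasDim (unionOfLines B) (n + 1)) :
    ∃ G ∉ vanishingIdeal K (incidenceCone B), ∀ r ∈ B,
      Module.finrank K (tangentSpace B r) ≤ n → ∀ c : K, c ≠ 0 → ∀ w : Vec K N,
        eval (Sum.elim (c • plueckerVec r) w) G ≠ 0 →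
          IsGeneralPoint n B r ⟨act (plueckerVec r) w, act_plueckerVec_mem r w⟩ := by
  have hI := isPrime_vanishingIdeal_incidenceCone hB
  have hcomap := comap_vanishingIdeal_incidenceCone B
  have hU : (idealOf (unionOfLines B)).IsPrime := hcomap ▸ Ideal.comap_isPrime _ _
  obtain ⟨G₁, hG₁, hle⟩ := exists_eval_ne_zero_le_finrank_map_tangentAt (d := n + 2) hI actPoly
    (by rw [hcomap]; exact hX.ge)
  obtain ⟨G₂, hG₂, hge⟩ := exists_eval_ne_zero_finrank_tangentAt_le (d := n + 2)
    (S := coneOf (unionOfLines B)) (idealOf_eq_vanishingIdeal (unionOfLines B) ▸ hU)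
    (by rw [← idealOf_eq_vanishingIdeal]; exact hX.le)
  obtain ⟨i, hi⟩ := exists_X_notMem_idealOf hU.ne_top
  rw [← idealOf_eq_vanishingIdeal] at hG₂
  have hG₃ : bind₁ actPoly (G₂ * X i) ∉ vanishingIdeal K (incidenceCone B) := by
    rw [← Ideal.mem_comap, hcomap]
    exact fun h => (hU.mem_or_mem h).elim hG₂ hi
  refine ⟨G₁ * bind₁ actPoly (G₂ * X i), fun h => (hI.mem_or_mem h).elim hG₁ hG₃,
    fun r hr hr' c hc w hw => ?_⟩
  rw [map_mul, eval_bind₁, eval_actPoly, map_mul, eval_X, Sum.elim_comp_inl, Sum.elim_comp_inr,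
    map_smul, LinearMap.smul_apply] at hw
  have hv : c • act (plueckerVec r) w ≠ 0 := fun h0 =>
    right_ne_zero_of_mul (right_ne_zero_of_mul hw) (congrFun h0 i)
  have hdim := hle (Sum.elim (c • plueckerVec r) w)
    ⟨smul_mem_coneOf (plueckerVec_mem_coneOf hr) hc, Set.mem_univ _⟩ (left_ne_zero_of_mul hw)
  have hdim' := hge _ (left_ne_zero_of_mul (right_ne_zero_of_mul hw))
  have hmap := map_tangentAt_incidenceCone_le_tangentAt B (Sum.elim (c • plueckerVec r) w)
  rw [Sum.elim_comp_inl, Sum.elim_comp_inr, map_smul, LinearMap.smul_apply] at hmap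
  rw [tangentAt_coneOf_smul _ _ hc] at hdim' hmap
  have heq := Submodule.eq_of_le_of_finrank_le hmap (hdim'.trans hdim)
  refine ⟨right_ne_zero_of_smul hv, hdim'.antisymm (heq ▸ hdim), Submodule.eq_of_le_of_finrank_le
    (heq ▸ map_tangentAt_incidenceCone_le B r hc w) ?_⟩
  rw [finrank_comap_mkQ, r.2]
  exact (Nat.add_le_add_right ((LinearMap.finrank_range_le _).trans hr') 2).trans (heq ▸ hdim)

theorem forGeneral_finrank_tangentSpace_le (hB : (idealOf (pluecker '' B)).IsPrime)
    (hBdim : HasDim (pluecker '' B) n) :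
    ForGeneral B fun r => Module.finrank K (tangentSpace B r) ≤ n := by
  rw [HasDim, coneDim, idealOf_eq_vanishingIdeal] at hBdim
  obtain ⟨G, hG, hle⟩ := exists_eval_ne_zero_finrank_tangentAt_le
    (idealOf_eq_vanishingIdeal (pluecker '' B) ▸ hB) hBdim.le
  rw [← idealOf_eq_vanishingIdeal] at hG
  refine forGeneral_of_eval_ne_zero hG fun r hr c hc hGr => Nat.le_of_lt_succ ?_
  have hdim := hle _ hGr
  rw [tangentAt_coneOf_smul _ _ hc] at hdim
  exact (finrank_tangentSpace_lt hr).trans_le hdim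

theorem forGeneral_isGeneralLine (hB : (idealOf (pluecker '' B)).IsPrime)
    (hBdim : HasDim (pluecker '' B) n) (hX : HasDim (unionOfLines B) (n + 1)) :
    ForGeneral B (IsGeneralLine n B) := by
  obtain ⟨G, hG, hgen⟩ := exists_isGeneralPoint_of_eval_ne_zero hB hX
  obtain ⟨q, hq, w₀, -, hqw⟩ := notMem_vanishingIdeal_prodSet.1 hG
  have hG₀ : bind₁ (Sum.elim X fun j => C (w₀ j)) G ∉ idealOf (pluecker '' B) := fun h =>
    hqw ((eval_bind₁_elim_X_C G q w₀).symm.trans (h q hq.1 hq.2))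
  refine ((forGeneral_finrank_tangentSpace_le hB hBdim).and hB <|
    forGeneral_of_eval_ne_zero (P := fun r => ∃ c : K, c ≠ 0 ∧
      eval (Sum.elim (c • plueckerVec r) w₀) G ≠ 0) hG₀
      fun r _ c hc hGr => ⟨c, hc, eval_bind₁_elim_X_C G _ w₀ ▸ hGr⟩).mono ?_
  rintro r hr ⟨hle, c, hc, hGr⟩
  refine ⟨hle.antisymm (hgen r hr hle c hc w₀ hGr).le_finrank_tangentSpace, ?_⟩
  have hGc : bind₁ (Sum.elim (fun i => C ((c • plueckerVec r) i)) X) G ≠ 0 := fun h =>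
    hGr ((eval_bind₁_elim_C_X G _ w₀).symm.trans (by rw [h, map_zero]))
  refine eq_bot_iff.2 ((vanishingIdeal_anti_mono ?_).trans
    (vanishingIdeal_image_eval_ne_zero (lineCoord_surjective r) hGc).le)
  rintro _ ⟨w, hw, rfl⟩
  rw [Set.mem_ofPred_eq, lineVec_lineCoord]
  exact hgen r hr hle c hc w (eval_bind₁_elim_C_X G _ w ▸ hw)

end GeneralLines

section BinaryForms

section Homogeneous

variable {R σ : Type*} [CommRing R]

theorem homogeneousSubmodule_eq_restrictSupport [Fintype σ] [DecidableEq σ] (e : ℕ) :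
    homogeneousSubmodule σ R e =
      restrictSupport R ((Finset.univ : Finset σ).finsuppAntidiag e : Finset (σ →₀ ℕ)) := by
  rw [homogeneousSubmodule_eq_finsupp_supported, restrictSupport]
  congr 1
  ext d
  simp [Finsupp.degree_eq_sum]

theorem finrank_homogeneousSubmodule [Nontrivial R] [Fintype σ] (e : ℕ) :
    Module.finrank R (homogeneousSubmodule σ R e) = (Fintype.card σ).multichoose e := by
  classical
  rw [homogeneousSubmodule_eq_restrictSupport,
    Module.finrank_eq_nat_card_basis (basisRestrictSupport R _), Nat.card_eq_card_toFinset,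
    Finset.toFinset_coe, Finset.card_finsuppAntidiag_nat_eq_multichoose, Finset.card_univ]

instance [Finite σ] (e : ℕ) : Module.Finite R (homogeneousSubmodule σ R e) := by
  classical
  have := Fintype.ofFinite σ
  rw [homogeneousSubmodule_eq_restrictSupport]
  exact Module.Finite.of_basis (basisRestrictSupport R _)

theorem homogeneousComponent_mul_of_isHomogeneous {n : ℕ} {F : MvPolynomial σ R}
    (hF : F.IsHomogeneous n) (G : MvPolynomial σ R) (m : ℕ) :
    homogeneousComponent (n + m) (F * G) = F * homogeneousComponent m G := by
  conv_lhs => rw [← sum_homogeneousComponent G]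
  have h (i : ℕ) : homogeneousComponent (n + m) (F * homogeneousComponent i G) =
      if i = m then F * homogeneousComponent i G else 0 := by
    rw [homogeneousComponent_of_mem (hF.mul (homogeneousComponent_isHomogeneous i G))]
    simp only [Nat.add_left_cancel_iff, eq_comm]
  simp only [Finset.mul_sum, map_sum, h, Finset.sum_ite_eq', Finset.mem_range]
  split_ifs with hm
  · rfl
  · rw [homogeneousComponent_eq_zero _ _ (by omega), mul_zero]

/-- The degree `e` part of an ideal of a polynomial ring. -/
def degreePart (J : Ideal (MvPolynomial σ R)) (e : ℕ) :
    Submodule R (homogeneousSubmodule σ R e) :=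
  (J.restrictScalars R).comap (homogeneousSubmodule σ R e).subtype

theorem mem_degreePart {J : Ideal (MvPolynomial σ R)} {e : ℕ} {G : homogeneousSubmodule σ R e} :
    G ∈ degreePart J e ↔ (G : MvPolynomial σ R) ∈ J := Iff.rfl

/-- Multiplication by a form `F` of degree `n`, from the forms of degree `m` to those of degree
`n + m`. -/
def mulForm {n : ℕ} {F : MvPolynomial σ R} (hF : F.IsHomogeneous n) (m : ℕ) :
    homogeneousSubmodule σ R m →ₗ[R] homogeneousSubmodule σ R (n + m) :=
  (LinearMap.mulLeft R F).restrict fun _ hG => hF.mul hG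

theorem mulForm_injective [IsDomain R] {n : ℕ} {F : MvPolynomial σ R}
    (hF : F.IsHomogeneous n) (hF0 : F ≠ 0) (m : ℕ) : Function.Injective (mulForm hF m) :=
  fun _ _ h => Subtype.ext (mul_left_cancel₀ hF0 (congrArg Subtype.val h))

theorem range_mulForm {n : ℕ} {F : MvPolynomial σ R} (hF : F.IsHomogeneous n) (m : ℕ) :
    LinearMap.range (mulForm hF m) = degreePart (Ideal.span {F}) (n + m) := by
  refine le_antisymm ?_ fun G hG => ?_
  · rintro _ ⟨H, rfl⟩
    exact Ideal.mul_mem_right _ _ (Ideal.mem_span_singleton_self F)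
  · obtain ⟨H, hH⟩ := Ideal.mem_span_singleton.1 (mem_degreePart.1 hG)
    refine ⟨⟨homogeneousComponent m H, homogeneousComponent_isHomogeneous m H⟩, Subtype.ext ?_⟩
    refine (homogeneousComponent_mul_of_isHomogeneous hF H m).symm.trans ?_
    rw [← hH]
    exact homogeneousComponent_eq_self G.2

end Homogeneous

variable {K : Type*} [Field K]
  {J : Ideal (MvPolynomial (Fin 2) K)} {n : ℕ} {F G : MvPolynomial (Fin 2) K}

theorem hasLength_iff_finrank_degreePart :
    HasLength J n ↔ ∀ᶠ m in Filter.atTop, Module.finrank K (degreePart J (n + m)) = m + 1 := by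
  have hfin (e : ℕ) : Module.finrank K (homogeneousSubmodule (Fin 2) K e ⧸ degreePart J e) +
      Module.finrank K (degreePart J e) = e + 1 := by
    rw [Submodule.finrank_quotient_add_finrank, finrank_homogeneousSubmodule, Fintype.card_fin,
      Nat.multichoose_two]
  conv_lhs => rw [HasLength, ← Filter.map_add_atTop_eq_nat n, Filter.eventually_map]
  refine Filter.eventually_congr (.of_forall fun m => ?_)
  have iff_of_add_eq {a b : ℕ} (h : a + b = n + m + 1) : a = n ↔ b = m + 1 := by omega
  rw [add_comm m n]
  exact iff_of_add_eq (hfin (n + m))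

theorem finrank_degreePart_span_singleton (hF : F.IsHomogeneous n) (hF0 : F ≠ 0) (m : ℕ) :
    Module.finrank K (degreePart (Ideal.span {F}) (n + m)) = m + 1 := by
  rw [← range_mulForm hF, LinearMap.finrank_range_of_inj (mulForm_injective hF hF0 m),
    finrank_homogeneousSubmodule, Fintype.card_fin, Nat.multichoose_two]

theorem hasLength_span_singleton (hF : F.IsHomogeneous n) (hF0 : F ≠ 0) :
    HasLength (Ideal.span {F}) n :=
  hasLength_iff_finrank_degreePart.2 (.of_forall (finrank_degreePart_span_singleton hF hF0))

theorem dvd_of_dvd_mul_of_isRelPrime {M : Type*} [CommMonoidWithZero M] [IsLeftCancelMulZero M]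
    [DecompositionMonoid M] {a b c d : M} (hcd : IsRelPrime c d) (hc : a ∣ b * c)
    (hd : a ∣ b * d) : a ∣ b := by
  obtain ⟨a₁, a₂, ⟨b, rfl⟩, ha₂, rfl⟩ := exists_dvd_and_dvd_of_dvd_mul hc
  obtain rfl | ha₁ := eq_or_ne a₁ 0
  · simp only [zero_mul, dvd_refl]
  rw [mul_assoc] at hd
  exact mul_dvd_mul_left a₁ ((hcd.of_dvd_left ha₂).dvd_of_dvd_mul_right
    ((mul_dvd_mul_iff_left ha₁).1 hd))

theorem isRelPrime_X_pow {R σ : Type*} [CommRing R] [IsDomain R] [UniqueFactorizationMonoid R]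
    {i j : σ} (hij : i ≠ j) (m : ℕ) : IsRelPrime (X i ^ m : MvPolynomial σ R) (X j ^ m) :=
  ((X_prime.irreducible.isRelPrime_iff_not_dvd).2 fun h => hij (X_dvd_X.1 h)).pow

theorem HasLength.exists_eq_smul (hJ : HasLength J n) (hF : F.IsHomogeneous n) (hF0 : F ≠ 0)
    (hFJ : F ∈ J) (hG : G.IsHomogeneous n) (hGJ : G ∈ J) : ∃ c : K, G = c • F := by
  obtain ⟨m, hm⟩ := (hasLength_iff_finrank_degreePart.1 hJ).exists
  have hJm : degreePart (Ideal.span {F}) (n + m) = degreePart J (n + m) :=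
    Submodule.eq_of_le_of_finrank_le
      (Submodule.comap_mono ((Ideal.span_singleton_le_iff_mem J).2 hFJ))
      (hm.trans (finrank_degreePart_span_singleton hF hF0 m).symm).le
  have hdvd (i : Fin 2) : F ∣ G * X i ^ m := by
    have hX : (X i ^ m : MvPolynomial (Fin 2) K).IsHomogeneous m := isHomogeneous_X_pow i m
    refine Ideal.mem_span_singleton.1 ?_
    have h : (⟨_, hG.mul hX⟩ : homogeneousSubmodule (Fin 2) K (n + m)) ∈ degreePart J (n + m) :=
      J.mul_mem_right _ hGJ
    rwa [← hJm] at h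
  obtain ⟨H, rfl⟩ := dvd_of_dvd_mul_of_isRelPrime (isRelPrime_X_pow zero_ne_one m)
    (hdvd 0) (hdvd 1)
  refine ⟨coeff 0 H, ?_⟩
  have h := homogeneousComponent_mul_of_isHomogeneous hF H 0
  rw [add_zero, homogeneousComponent_eq_self hG, homogeneousComponent_zero] at h
  rw [h, mul_comm, C_mul']

end BinaryForms

section Pencils

theorem isHomogeneous_det {R σ ι : Type*} [CommRing R] [Fintype ι] [DecidableEq ι]
    {M : Matrix ι ι (MvPolynomial σ R)} {d : ℕ} (hM : ∀ i j, (M i j).IsHomogeneous d) :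
    M.det.IsHomogeneous (Fintype.card ι * d) := by
  rw [Matrix.det_apply]
  refine IsHomogeneous.sum _ _ _ fun π _ => ?_
  have hπ := IsHomogeneous.prod Finset.univ (fun i => M (π i) i) (fun _ => d) fun i _ => hM _ i
  rw [Finset.sum_const, smul_eq_mul, Finset.card_univ] at hπ
  exact zsmul_mem ((mem_homogeneousSubmodule _ _).2 hπ) _

theorem det_mul_apply_eq_zero {R ι : Type*} [CommRing R] [Fintype ι] [DecidableEq ι]
    {M : Matrix ι ι R} {c : ι → R} (h : ∀ i, (M.updateRow i c).det = 0) (j : ι) :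
    M.det * c j = 0 := by
  have hcramer : M.transpose.cramer c = 0 :=
    funext fun i => (Matrix.cramer_transpose_apply M c i).trans (h i)
  have hmul := congrFun (Matrix.mulVec_cramer M.transpose c) j
  rw [hcramer, Matrix.mulVec_zero, Matrix.det_transpose] at hmul
  exact hmul.symm

theorem det_dual_apply_endomorphism {K T ι : Type*} [CommRing K] [AddCommGroup T] [Module K T]
    [Fintype ι] [DecidableEq ι] (b : Module.Basis ι K T) (A : T →ₗ[K] T)
    (l : ι → Module.Dual K T) (η : ι → T) :
    (Matrix.of fun i j => l i (A (η j))).det =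
      (Matrix.of fun i j => l i (b j)).det * LinearMap.det A * (b.toMatrix η).det := by
  have hl (i : ι) (t : T) : l i t = ∑ k, l i (b k) * b.repr t k := by
    conv_lhs => rw [← b.sum_repr t, map_sum]
    simp only [map_smul, smul_eq_mul, mul_comm]
  rw [← LinearMap.det_toMatrix b, mul_assoc, ← Matrix.det_mul, ← Matrix.det_mul]
  congr 1
  ext i j
  rw [Matrix.mul_apply, Matrix.of_apply, hl]
  refine Finset.sum_congr rfl fun k _ => ?_
  rw [Matrix.of_apply, Matrix.mul_apply, ← LinearMap.toMatrix_mulVec_repr b b]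
  rfl

variable {K σ T W : Type*} [Field K] [Fintype σ] [DecidableEq σ] [AddCommGroup T] [Module K T]
  [AddCommGroup W] [Module K W]

/-- The linear form `x ↦ l (φ x η)`, for a linear system `φ` of linear maps `T → W` parametrized
by `K^σ`. -/
def pencilEntry (φ : (σ → K) →ₗ[K] T →ₗ[K] W) (l : Module.Dual K W) (η : T) :
    MvPolynomial σ K :=
  ∑ k, C (l (φ (Pi.single k 1) η)) * X k

/-- The minor of a linear system `φ` of linear maps on the vectors `η j` and the linear forms
`l i`, as a polynomial in the parameter of the system. -/
def pencilMinor (φ : (σ → K) →ₗ[K] T →ₗ[K] W) {n : ℕ} (l : Fin n → Module.Dual K W)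
    (η : Fin n → T) : MvPolynomial σ K :=
  (Matrix.of fun i j => pencilEntry φ (l i) (η j)).det

/-- The ideal generated by the minors of order `n` of a linear system of linear maps. -/
def pencilIdeal (φ : (σ → K) →ₗ[K] T →ₗ[K] W) (n : ℕ) : Ideal (MvPolynomial σ K) :=
  Ideal.span {F | ∃ (l : Fin n → Module.Dual K W) (η : Fin n → T), F = pencilMinor φ l η}

variable (φ : (σ → K) →ₗ[K] T →ₗ[K] W) {n : ℕ}

theorem eval_pencilEntry (l : Module.Dual K W) (η : T) (x : σ → K) :
    eval x (pencilEntry φ l η) = l (φ x η) := by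
  conv_rhs => rw [pi_eq_sum_univ' x]
  simp only [pencilEntry, map_sum, map_mul, eval_C, eval_X, map_smul, LinearMap.sum_apply,
    LinearMap.smul_apply, smul_eq_mul, mul_comm]

theorem eval_pencilMinor (l : Fin n → Module.Dual K W) (η : Fin n → T) (x : σ → K) :
    eval x (pencilMinor φ l η) = (Matrix.of fun i j => l i (φ x (η j))).det := by
  rw [pencilMinor, RingHom.map_det]
  congr 1
  ext i j
  exact eval_pencilEntry φ (l i) (η j) x

theorem isHomogeneous_pencilMinor (l : Fin n → Module.Dual K W) (η : Fin n → T) :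
    (pencilMinor φ l η).IsHomogeneous n := by
  have hentry (i j : Fin n) : (pencilEntry φ (l i) (η j)).IsHomogeneous 1 :=
    IsHomogeneous.sum _ _ _ fun k _ => isHomogeneous_C_mul_X _ k
  have hdet := isHomogeneous_det (M := Matrix.of fun i j => pencilEntry φ (l i) (η j)) hentry
  rwa [Fintype.card_fin, mul_one] at hdet

theorem pencilMinor_mem_pencilIdeal (l : Fin n → Module.Dual K W) (η : Fin n → T) :
    pencilMinor φ l η ∈ pencilIdeal φ n :=
  Ideal.subset_span ⟨l, η, rfl⟩

theorem pencilMinor_update (l : Fin n → Module.Dual K W) (η : Fin n → T) (m : Fin n)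
    (f : Module.Dual K W) : pencilMinor φ (Function.update l m f) η =
      ((Matrix.of fun i j => pencilEntry φ (l i) (η j)).updateRow m
        fun j => pencilEntry φ f (η j)).det := by
  rw [pencilMinor]
  congr 1
  ext1 i j
  rw [Matrix.updateRow_apply, Matrix.of_apply, Matrix.of_apply, Function.update_apply]
  split_ifs <;> rfl

theorem pencilMinor_mul_pencilEntry_eq_zero {l : Fin n → Module.Dual K W} {η : Fin n → T}
    {f : Module.Dual K W} (h : ∀ m, pencilMinor φ (Function.update l m f) η = 0) (j : Fin n) :
    pencilMinor φ l η * pencilEntry φ f (η j) = 0 :=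
  det_mul_apply_eq_zero (fun m => (pencilMinor_update φ l η m f).symm.trans (h m)) j

section Retraction

variable {φ} (b : Module.Basis (Fin n) K T) {g : W →ₗ[K] T} {x₀ : σ → K}

theorem eval_pencilMinor_coord_comp (g : W →ₗ[K] T) (x : σ → K) :
    eval x (pencilMinor φ (fun i => b.coord i ∘ₗ g) b) = LinearMap.det (g ∘ₗ φ x) := by
  rw [eval_pencilMinor, ← LinearMap.det_toMatrix b]
  congr 1
  ext i j
  rw [LinearMap.toMatrix_apply]
  rfl

theorem eval_pencilMinor_coord_comp_eq_one (hg : g ∘ₗ φ x₀ = .id) :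
    eval x₀ (pencilMinor φ (fun i => b.coord i ∘ₗ g) b) = 1 := by
  rw [eval_pencilMinor_coord_comp, hg, LinearMap.det_id]

theorem pencilMinor_coord_comp_ne_zero (hg : g ∘ₗ φ x₀ = .id) :
    pencilMinor φ (fun i => b.coord i ∘ₗ g) b ≠ 0 := fun h => by
  simpa only [h, map_zero, zero_ne_one] using eval_pencilMinor_coord_comp_eq_one b hg

theorem pencilIdeal_eq_span_singleton [Infinite K] (hg : g ∘ₗ φ x₀ = .id)
    (h : ∀ x, LinearMap.range (φ x) ≤ LinearMap.range (φ x₀)) :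
    pencilIdeal φ n = Ideal.span {pencilMinor φ (fun i => b.coord i ∘ₗ g) b} := by
  have hφ (x : σ → K) (t : T) : φ x t = φ x₀ ((g ∘ₗ φ x) t) := by
    obtain ⟨s, hs⟩ := h x ⟨t, rfl⟩
    rw [LinearMap.comp_apply, ← hs]
    exact congrArg (φ x₀) (LinearMap.congr_fun hg s).symm
  refine le_antisymm (Ideal.span_le.2 ?_)
    ((Ideal.span_singleton_le_iff_mem _).2 (pencilMinor_mem_pencilIdeal φ _ _))
  rintro _ ⟨l, η, rfl⟩
  have hminor : pencilMinor φ l η = C (Matrix.of fun i j => l i (φ x₀ (b j))).det *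
      pencilMinor φ (fun i => b.coord i ∘ₗ g) b * C (b.toMatrix η).det :=
    MvPolynomial.funext fun x => by
      rw [map_mul, map_mul, eval_C, eval_C, eval_pencilMinor_coord_comp, eval_pencilMinor]
      simp only [hφ x]
      exact det_dual_apply_endomorphism b (g ∘ₗ φ x) (fun i => l i ∘ₗ φ x₀) η
  rw [hminor]
  exact Ideal.mul_mem_right _ _ (Ideal.mul_mem_left _ _ (Ideal.mem_span_singleton_self _))

end Retraction

variable {φ : (Fin 2 → K) →ₗ[K] T →ₗ[K] W} {x₀ : Fin 2 → K}

/- Replacing one of the linear forms of a nonzero maximal minor `F` by a form `f` that vanishes on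
the range of `φ x₀` gives a minor that vanishes at `x₀`; being a multiple of `F`, which does not
vanish there, it is zero. Cramer's rule then kills `f ∘ φ x`. -/
theorem HasLength.pencilEntry_eq_zero (b : Module.Basis (Fin n) K T) {g : W →ₗ[K] T}
    (hg : g ∘ₗ φ x₀ = .id) (hJ : HasLength (pencilIdeal φ n) n) {f : Module.Dual K W}
    (hf : f ∘ₗ φ x₀ = 0) (j : Fin n) : pencilEntry φ f (b j) = 0 := by
  have hF0 := pencilMinor_coord_comp_ne_zero b hg
  refine (mul_eq_zero.1 (pencilMinor_mul_pencilEntry_eq_zero φ (fun m => ?_) j)).resolve_left hF0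
  obtain ⟨c, hc⟩ := hJ.exists_eq_smul (isHomogeneous_pencilMinor φ _ b) hF0
    (pencilMinor_mem_pencilIdeal φ _ b) (isHomogeneous_pencilMinor φ _ b)
    (pencilMinor_mem_pencilIdeal φ (Function.update (fun i => b.coord i ∘ₗ g) m f) b)
  have heval := congrArg (eval x₀) hc
  rw [smul_eval, eval_pencilMinor_coord_comp_eq_one b hg, mul_one, eval_pencilMinor,
    Matrix.det_eq_zero_of_row_eq_zero m fun k => by
      rw [Matrix.of_apply, Function.update_self]
      exact LinearMap.congr_fun hf (b k)] at heval
  rw [hc, ← heval, zero_smul]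

theorem hasLength_pencilIdeal_iff [Infinite K] [FiniteDimensional K T]
    (hT : Module.finrank K T = n) (hrank : Module.finrank K (LinearMap.range (φ x₀)) = n) :
    HasLength (pencilIdeal φ n) n ↔ ∀ x, LinearMap.range (φ x) ≤ LinearMap.range (φ x₀) := by
  have b := Module.finBasisOfFinrankEq K T hT
  have hinj : Function.Injective (φ x₀) := by
    have hker := (φ x₀).finrank_range_add_finrank_ker
    rw [hrank, hT, Nat.add_eq_left, Submodule.finrank_eq_zero] at hker
    exact LinearMap.ker_eq_bot.1 hker
  obtain ⟨g, hg⟩ := (φ x₀).exists_leftInverse_of_injective (LinearMap.ker_eq_bot.2 hinj)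
  refine ⟨fun hJ x => ?_, fun h => ?_⟩
  · by_contra hx
    obtain ⟨w, hw, hw₀⟩ := SetLike.not_le_iff_exists.1 hx
    obtain ⟨f, hfw, hf⟩ := Submodule.exists_le_ker_of_notMem hw₀
    have hfx : f ∘ₗ φ x = 0 := b.ext fun j =>
      (eval_pencilEntry φ f (b j) x).symm.trans <| by
        rw [hJ.pencilEntry_eq_zero b hg (LinearMap.range_le_ker_iff.1 hf), map_zero,
          LinearMap.zero_apply]
    exact hfw (LinearMap.range_le_ker_iff.2 hfx hw)
  · rw [pencilIdeal_eq_span_singleton b hg h]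
    exact hasLength_span_singleton (isHomogeneous_pencilMinor φ _ b)
      (pencilMinor_coord_comp_ne_zero b hg)

end Pencils

section LinearFamilies

variable {K : Type*} [Field K] {σ τ : Type}

theorem range_le_of_vanishingIdeal_eq_bot [Finite σ] {T W : Type*} [AddCommGroup T] [Module K T]
    [AddCommGroup W] [Module K W] {S : Set (σ → K)} (hS : vanishingIdeal K S = ⊥)
    (φ : (σ → K) →ₗ[K] T →ₗ[K] W) {R : Submodule K W} (hR : ∀ x ∈ S, LinearMap.range (φ x) ≤ R)
    (x : σ → K) : LinearMap.range (φ x) ≤ R := by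
  classical
  have := Fintype.ofFinite σ
  rintro _ ⟨η, rfl⟩
  by_contra hη
  obtain ⟨l, hl, hRl⟩ := Submodule.exists_le_ker_of_notMem hη
  have hentry : pencilEntry φ l η ∈ vanishingIdeal K S := fun y hy =>
    (eval_pencilEntry φ l η y).trans (hRl (hR y hy ⟨η, rfl⟩))
  rw [← eval_pencilEntry, (Submodule.eq_bot_iff _).1 hS _ hentry, map_zero] at hl
  exact hl rfl

variable [Fintype σ]

theorem le_tangentAt_of_vanishingIdeal_eq_bot [Finite τ] {S : Set (σ → K)} {T : Set (τ → K)}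
    (hT : vanishingIdeal K T = ⊥) (L : (τ → K) →ₗ[K] σ → K) {P : Submodule K (σ → K)}
    (hP : ∀ x ∈ T, P ≤ tangentAt S (L x)) (x : τ → K) : P ≤ tangentAt S (L x) := by
  classical
  have := Fintype.ofFinite τ
  refine fun a ha => mem_tangentAt.2 fun F hF => ?_
  let D := bind₁ L.toMatrix'.toMvPolynomial (mkDerivation K (fun i => C (a i)) F)
  have hD (x : τ → K) : eval x D = polyDifferential F (L x) a := by
    rw [eval_bind₁, eval_toMvPolynomial_toMatrix', polyDifferential_apply_eq_eval]
  have hD₀ : D ∈ vanishingIdeal K T := fun x hx =>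
    (hD x).trans (mem_tangentAt.1 (hP x hx ha) F hF)
  rw [← hD, (Submodule.eq_bot_iff _).1 hT D hD₀, map_zero]

theorem exists_finrank_iInf_tangentAt_le {κ : Type*} [Finite τ] (S : Set (σ → K))
    (L : κ → (τ → K) →ₗ[K] σ → K) (x₀ : τ → K) :
    ∃ D : MvPolynomial τ K, eval x₀ D ≠ 0 ∧ ∀ x, eval x D ≠ 0 →
      Module.finrank K (⨅ k, tangentAt S (L k x) : Submodule K (σ → K)) ≤
        Module.finrank K (⨅ k, tangentAt S (L k x₀) : Submodule K (σ → K)) := by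
  classical
  have := Fintype.ofFinite τ
  let M : Matrix (vanishingIdeal K S × κ) σ (MvPolynomial τ K) := Matrix.of fun p i =>
    bind₁ (L p.2).toMatrix'.toMvPolynomial (pderiv i (p.1 : MvPolynomial σ K))
  have hM (x : τ → K) :
      LinearMap.ker (M.map (eval x)).mulVecLin = ⨅ k, tangentAt S (L k x) := by
    have hrow (a : σ → K) (p : vanishingIdeal K S × κ) : (M.map (eval x)).mulVec a p =
        polyDifferential (p.1 : MvPolynomial σ K) (L p.2 x) a := by
      simp only [M, Matrix.mulVec, dotProduct, Matrix.map_apply, Matrix.of_apply, eval_bind₁,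
        eval_toMvPolynomial_toMatrix', polyDifferential_apply]
    ext a
    simp only [LinearMap.mem_ker, Matrix.mulVecLin_apply, funext_iff, hrow, Pi.zero_apply,
      Submodule.mem_iInf, mem_tangentAt, Prod.forall, Subtype.forall]
    exact ⟨fun h k F hF => h F hF k, fun h F hF k => h k F hF⟩
  obtain ⟨D, hD, hle⟩ := exists_finrank_ker_mulVecLin_le (E := K) M (eval x₀)
  refine ⟨D, hD, fun x hx => ?_⟩
  rw [← hM x, ← hM x₀]
  exact hle (eval x) hx

end LinearFamilies

section CommonTangent

variable {K : Type*} [Field K] {n N : ℕ} {B : Set (Line K N)} {X : Set (ℙ K (Vec K N))}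
  {r : Line K N}

/-- The vectors of `V` that are tangent to the cone over `X` at all the points of `r̂`, the vertex
included. -/
def commonTangent (X : Set (ℙ K (Vec K N))) (r : Line K N) : Submodule K (Vec K N) :=
  ⨅ v : r.1, tangentAt (coneOf X) (v : Vec K N)

theorem commonTangent_le (v : r.1) : commonTangent X r ≤ tangentAt (coneOf X) (v : Vec K N) :=
  iInf_le _ v

theorem commonTangent_eq_iInf_act (X : Set (ℙ K (Vec K N))) (r : Line K N) {c : K} (hc : c ≠ 0) :
    commonTangent X r = ⨅ w, tangentAt (coneOf X) (act (c • plueckerVec r) w) := by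
  simp only [map_smul, LinearMap.smul_apply, tangentAt_coneOf_smul X _ hc]
  refine le_antisymm (le_iInf fun w => commonTangent_le ⟨_, act_plueckerVec_mem r w⟩)
    (le_iInf fun v => ?_)
  obtain ⟨w, hw⟩ := (range_act_plueckerVec r).ge v.2
  exact hw ▸ iInf_le (fun w => tangentAt (coneOf X) (act (plueckerVec r) w)) w

theorem forGeneral_finrank_commonTangent_le [Infinite K] (X : Set (ℙ K (Vec K N))) (hr : r ∈ B) :
    ForGeneral B fun s =>
      Module.finrank K (commonTangent X s) ≤ Module.finrank K (commonTangent X r) := by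
  obtain ⟨D, hD, hle⟩ :=
    exists_finrank_iInf_tangentAt_le (coneOf X) (fun w => act.flip w) ((1 : K) • plueckerVec r)
  refine forGeneral_of_eval_ne_zero
    (fun h => hD (mem_idealOf_pluecker.1 h r hr 1 one_ne_zero)) fun s _ c hc hs => ?_
  rw [commonTangent_eq_iInf_act X s hc, commonTangent_eq_iInf_act X r one_ne_zero]
  exact hle _ hs

theorem constantTangentAlong_of_le_finrank_commonTangent {d : ℕ} (hX : HasDim X d)
    (h : d + 1 ≤ Module.finrank K (commonTangent X r)) : ConstantTangentAlong X r := by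
  refine ⟨commonTangent X r, fun x hxr hx => ?_⟩
  have hdim : Module.finrank K (embTangent X x) = d + 1 := Nat.cast_injective (hx.2.trans hX)
  induction x using Projectivization.ind with | h v hv =>
  rw [Projectivization.submodule_mk, Submodule.span_singleton_le_iff_mem] at hxr
  rw [embTangent_mk] at hdim ⊢
  exact (Submodule.eq_of_le_of_finrank_le (commonTangent_le ⟨v, hxr⟩) (hdim.trans_le h)).symm

end CommonTangent

section FocalLocus

variable {K : Type*} [Field K] {n N : ℕ} {B : Set (Line K N)} {r : Line K N}

/-- The characteristic map relative to `r` at the vector with coordinates `x` in the chosen basis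
of `r̂`, as a linear system parametrized by `x`. -/
def focalPencil (B : Set (Line K N)) (r : Line K N) :
    (Fin 2 → K) →ₗ[K] tangentSpace B r →ₗ[K] Vec K N ⧸ r.1 :=
  -(evalTangent B r ∘ₗ (lineVec r).toLinearMap)

theorem focalPencil_apply (B : Set (Line K N)) (r : Line K N) (x : Fin 2 → K) :
    focalPencil B r x = -evalTangent B r (lineVec r x) := rfl

theorem range_focalPencil (B : Set (Line K N)) (r : Line K N) (x : Fin 2 → K) :
    LinearMap.range (focalPencil B r x) = LinearMap.range (evalTangent B r (lineVec r x)) :=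
  LinearMap.range_neg _

theorem pencilEntry_focalPencil (B : Set (Line K N)) (r : Line K N)
    (l : Module.Dual K (Vec K N ⧸ r.1)) (η : tangentSpace B r) :
    pencilEntry (focalPencil B r) l η = characteristicEntry B r l η := by
  refine Finset.sum_congr rfl fun k _ => ?_
  have hk : lineVec r (Pi.single k 1) = lineBasis r k := by
    simp [lineVec]
  rw [characteristicMap_apply, focalPencil_apply, hk]
  rfl

theorem focalIdeal_eq_pencilIdeal (B : Set (Line K N)) (r : Line K N) :
    focalIdeal B r =
      pencilIdeal (T := tangentSpace B r) (W := Vec K N ⧸ r.1) (focalPencil B r) (maxRank B r) := by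
  simp only [focalIdeal, pencilIdeal, pencilMinor, pencilEntry_focalPencil]

theorem IsGeneralLine.nonempty_isGeneralPoint (h : IsGeneralLine n B r) :
    ∃ x, IsGeneralPoint n B r (lineVec r x) := by
  by_contra! hempty
  refine one_ne_zero ((Submodule.eq_bot_iff _).1 h.vanishingIdeal_eq_bot 1 fun x hx => ?_)
  exact (hempty x hx).elim

theorem IsGeneralLine.maxRank_eq (h : IsGeneralLine n B r) : maxRank B r = n := by
  obtain ⟨x, hx⟩ := h.nonempty_isGeneralPoint
  rw [maxRank, h.finrank_tangentSpace, min_eq_left]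
  exact hx.finrank_range_evalTangent.ge.trans (Submodule.finrank_le _)

theorem IsGeneralLine.le_commonTangent (h : IsGeneralLine n B r) {P : Submodule K (Vec K N)}
    (hP : ∀ x, IsGeneralPoint n B r (lineVec r x) →
      P ≤ tangentAt (coneOf (unionOfLines B)) (lineVec r x : Vec K N)) :
    P ≤ commonTangent (unionOfLines B) r := by
  refine le_iInf fun v => ?_
  have hv := le_tangentAt_of_vanishingIdeal_eq_bot h.vanishingIdeal_eq_bot
    (r.1.subtype ∘ₗ (lineVec r).toLinearMap) hP ((lineVec r).symm v)
  rwa [LinearMap.comp_apply, LinearEquiv.coe_coe, LinearEquiv.apply_symm_apply] at hv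

theorem IsGeneralLine.hasLength_iff_range_le [Infinite K] (h : IsGeneralLine n B r)
    {x₀ : Fin 2 → K} (hx₀ : IsGeneralPoint n B r (lineVec r x₀)) :
    HasLength (focalIdeal B r) n ↔ ∀ x, LinearMap.range (focalPencil B r x) ≤
      LinearMap.range (focalPencil B r x₀) := by
  rw [focalIdeal_eq_pencilIdeal, h.maxRank_eq]
  refine hasLength_pencilIdeal_iff h.finrank_tangentSpace ?_
  rw [range_focalPencil]
  exact hx₀.finrank_range_evalTangent

theorem IsGeneralPoint.tangentAt_lineVec {x : Fin 2 → K}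
    (hx : IsGeneralPoint n B r (lineVec r x)) :
    tangentAt (coneOf (unionOfLines B)) (lineVec r x : Vec K N) =
      (LinearMap.range (focalPencil B r x)).comap r.1.mkQ :=
  (range_focalPencil B r x).symm ▸ hx.tangentAt_eq

theorem IsGeneralLine.hasLength_iff_le_finrank_commonTangent [Infinite K]
    (h : IsGeneralLine n B r) :
    HasLength (focalIdeal B r) n ↔
      n + 2 ≤ Module.finrank K (commonTangent (unionOfLines B) r) := by
  obtain ⟨x₀, hx₀⟩ := h.nonempty_isGeneralPoint
  rw [h.hasLength_iff_range_le hx₀]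
  refine ⟨fun hrange => ?_, fun hle => ?_⟩
  · refine hx₀.finrank_tangentAt.ge.trans
      (Submodule.finrank_mono (h.le_commonTangent fun x hx => ?_))
    refine (Submodule.eq_of_le_of_finrank_eq ?_
      (hx.finrank_tangentAt.trans hx₀.finrank_tangentAt.symm)).ge
    rw [hx.tangentAt_lineVec, hx₀.tangentAt_lineVec]
    exact Submodule.comap_mono (hrange x)
  · have hcommon (x : Fin 2 → K) (hx : IsGeneralPoint n B r (lineVec r x)) :
        commonTangent (unionOfLines B) r =
          (LinearMap.range (focalPencil B r x)).comap r.1.mkQ :=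
      (Submodule.eq_of_le_of_finrank_le (commonTangent_le _)
        (hx.finrank_tangentAt.trans_le hle)).trans hx.tangentAt_lineVec
    have hrange (x : Fin 2 → K) (hx : IsGeneralPoint n B r (lineVec r x)) :
        LinearMap.range (focalPencil B r x) = LinearMap.range (focalPencil B r x₀) :=
      Submodule.comap_injective_of_surjective (f := r.1.mkQ) r.1.mkQ_surjective <|
        (hcommon x hx).symm.trans (hcommon x₀ hx₀)
    have hdense := range_le_of_vanishingIdeal_eq_bot (T := tangentSpace B r) (W := Vec K N ⧸ r.1)
      h.vanishingIdeal_eq_bot (focalPencil B r) (R := LinearMap.range (focalPencil B r x₀))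
    exact hdense fun x hx => (hrange x hx).le

theorem IsGeneralPoint.isNonsingularAt {v : r.1} (h : IsGeneralPoint n B r v) (hr : r ∈ B)
    (hX : HasDim (unionOfLines B) (n + 1)) :
    IsNonsingularAt (unionOfLines B) (Projectivization.mk K (v : Vec K N) h.ne_zero) := by
  refine ⟨(mem_coneOf_unionOfLines.2 ⟨h.ne_zero, r, hr, v.2⟩).2, ?_⟩
  rw [embTangent_mk, h.finrank_tangentAt, hX]

theorem IsGeneralLine.constantTangentAlong_iff (h : IsGeneralLine n B r) (hr : r ∈ B)
    (hX : HasDim (unionOfLines B) (n + 1)) :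
    ConstantTangentAlong (unionOfLines B) r ↔
      n + 2 ≤ Module.finrank K (commonTangent (unionOfLines B) r) := by
  refine ⟨fun ⟨P, hP⟩ => ?_, constantTangentAlong_of_le_finrank_commonTangent hX⟩
  have hgen (x : Fin 2 → K) (hx : IsGeneralPoint n B r (lineVec r x)) :
      tangentAt (coneOf (unionOfLines B)) (lineVec r x : Vec K N) = P := by
    rw [← embTangent_mk _ _ hx.ne_zero]
    refine hP _ ?_ (hx.isNonsingularAt hr hX)
    rw [Projectivization.submodule_mk, Submodule.span_singleton_le_iff_mem]
    exact (lineVec r x).2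
  obtain ⟨x₀, hx₀⟩ := h.nonempty_isGeneralPoint
  rw [← hx₀.finrank_tangentAt, hgen x₀ hx₀]
  exact Submodule.finrank_mono (h.le_commonTangent fun x hx => (hgen x hx).ge)

end FocalLocus

end FocalLines

end

theorem mainTheorem7_general {K : Type*} [Field K] [CharZero K] {n N : ℕ}
    {B : Set (FocalLines.Line K N)}
    (hB : (FocalLines.idealOf (FocalLines.pluecker '' B)).IsPrime)
    (hBdim : FocalLines.HasDim (FocalLines.pluecker '' B) n)
    (hXdim : FocalLines.HasDim (FocalLines.unionOfLines B) (n + 1)) :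
    (FocalLines.ForGeneral B (fun r => FocalLines.HasLength (FocalLines.focalIdeal B r) n) ↔
      ∀ r ∈ B, FocalLines.ConstantTangentAlong (FocalLines.unionOfLines B) r) ∧
    (FocalLines.ForGeneral B (fun r => FocalLines.HasLength (FocalLines.focalIdeal B r) n) ↔
      FocalLines.ForGeneral B
        (fun r => FocalLines.ConstantTangentAlong (FocalLines.unionOfLines B) r)) := by
  have hgen := FocalLines.forGeneral_isGeneralLine hB hBdim hXdim
  have hfocal := FocalLines.ForGeneral.congr hB hgen fun r _ hr =>
    hr.hasLength_iff_le_finrank_commonTangent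
  have hconst := FocalLines.ForGeneral.congr hB hgen fun r hrB hr =>
    hr.constantTangentAlong_iff hrB hXdim
  refine ⟨⟨fun h r hr => ?_, fun h => ?_⟩, hfocal.trans hconst.symm⟩
  · obtain ⟨s, -, hs, hsr⟩ :=
      ((hfocal.1 h).and hB (FocalLines.forGeneral_finrank_commonTangent_le _ hr)).exists
    exact FocalLines.constantTangentAlong_of_le_finrank_commonTangent hXdim (hs.trans hsr)
  · exact (hfocal.trans hconst.symm).2 (FocalLines.forGeneral_of_forall hB.ne_top h)

theorem mainTheorem7 {K : Type*} [Field K] [IsAlgClosed K] [CharZero K] {n N : ℕ}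
    (hn : n + 2 ≤ N)
    (B : Set (FocalLines.Line K N))
    (hB : FocalLines.IsProjectiveVariety (FocalLines.pluecker '' B))
    (hBdim : FocalLines.HasDim (FocalLines.pluecker '' B) n)
    (X : Set (ℙ K (FocalLines.Vec K N)))
    (hXB : X = FocalLines.unionOfLines B)
    (hX : FocalLines.IsProjectiveVariety X)
    (hXdim : FocalLines.HasDim X (n + 1)) :
    (FocalLines.ForGeneral B (fun r => FocalLines.HasLength (FocalLines.focalIdeal B r) n) ↔
      ∀ r ∈ B, FocalLines.ConstantTangentAlong X r) ∧
    (FocalLines.ForGeneral B (fun r => FocalLines.HasLength (FocalLines.focalIdeal B r) n) ↔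
      FocalLines.ForGeneral B (fun r => FocalLines.ConstantTangentAlong X r)) := by
  subst hXB
  exact mainTheorem7_general hB.2 hBdim hXdim
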